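/- Notation. For integers $a,b$ put $(a:b)=\{a,a+1,\dots,b\}$ (empty if $a>b$), and let $\mathcal I_{n,r}$ be the set of strictly increasing $r$-tuples from $(1:n)$, ordered lexicographically. For a real $p\times q$ matrix $X$, the $r$-th multiplicative compound $X_{[r]}\in\mathbb R^{\binom pr\times\binom qr}$ has $(i,j)$ entry $\det X_{I,J}$, where $I$, $J$ are the $i$-th and $j$-th elements of $\mathcal I_{p,r}$ and $\mathcal I_{q,r}$. For $A\in\mathbb R^{n\times n}$ and a row vector $c\in\mathbb R^{1\times n}$, the observability operator is $(\mathcal O x_0)(t)=cA^tx_0$, $x_0\in\mathbb R^n$, $t\ge 0$, and $\mathcal O^N\in\mathbb R^{N\times n}$ is the matrix with rows $c,cA,\dots,cA^{N-1}$; $(A,c)$ is observable if $\operatorname{rank}\mathcal O^n=n$. A system $(A,b,c)$ is strictly externally positive (negative) if its impulse response $g(t)=cA^{t-1}b$ satisfies $g(t)>0$ ($g(t)<0$) for all $t\ge1$. For a vector $u\neq 0$ let $S^-(u)$ be the number of sign changes in $u$ after deleting its zero entries, and for a sequence $y$ let $S^+(y)\in\{0,1,2,\dots\}\cup\{\infty\}$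 be the maximal number of sign changes obtainable by replacing the zero entries of $y$ by arbitrary real numbers. The operator $\mathcal O$ is strictly $m$-variation bounding if $S^+(\mathcal O u)\le m$ for every $u\ne0$ with $S^-(u)\le m$. Theorem. Let $(A,c)$ be observable and $k\in(1:n)$. For $r\in(1:k)$ and $\beta\in\mathcal I_{n,k}$ define $$\tilde A_r:=A_{[r]},\qquad \tilde c_r:=(\mathcal O^r)_{[r]},\qquad \tilde b_{k,r,\beta}:=\begin{pmatrix}\Big(A^{k-r}(\mathcal O^n)^{-1}\begin{pmatrix}0\\ I_{n-k+r}\end{pmatrix}\Big)_{[r]} & 0\end{pmatrix}(\mathcal O^nP_\beta)_{[k]},$$ where $P_\beta$ consists of the columns of $I_n$ indexed by $\beta$, and the zero block has $\binom nk-\binom{n-k+r}{r}$ columns. (i) For all $r\in(1:k)$, $\beta\in\mathcal I_{n,k}$, $N\ge1$, $t\in(1:N-k+1)$, and $\alpha=(1:k-r)\cup(k-r+t:k+t-1)$, $$\det\big(\mathcal O^N_{\alpha,\beta}\big)=\tilde c_r\,\tilde A_r^{\,t-1}\,\tilde b_{k,r,\beta}.$$ (ii) $\mathcal O$ is strictly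 $(k-1)$-variation bounding if and only if the systems $(\tilde A_r,\tilde b_{k,r,\beta},\tilde c_r)$, taken over all $r\in(1:k)$ and all $\beta=(1:k-\bar r)\cup(\bar t:\bar t+\bar r-1)$ with $\bar r\in(1:k)$ and $\bar t\in(k-\bar r+1:n-\bar r+1)$, are either all strictly externally positive or all strictly externally negative. -/

import Mathlib

open Matrix

noncomputable section

/-! ### Increasing index tuples and compound matrices -/

/-- The set `𝓘_{n,r}` of strictly increasing `r`-tuples of indices from `{1, …, n}` (represented by
`Fin n`), linearly ordered by the lexicographic order. -/
abbrev IncTuple (n r : ℕ) : Type :=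
  {v : Lex (Fin r → Fin n) // StrictMono (ofLex v)}

/-- The underlying function of an increasing tuple. -/
def IncTuple.idx {n r : ℕ} (v : IncTuple n r) : Fin r → Fin n := ofLex v.1

instance instFintypeIncTuple (n r : ℕ) : Fintype (IncTuple n r) :=
  Fintype.ofInjective (fun v : IncTuple n r => v.idx)
    (fun _ _ h => Subtype.ext (ofLex.injective h))

theorem card_incTuple (n r : ℕ) : Fintype.card (IncTuple n r) = n.choose r := by
  have e : IncTuple n r ≃ Set.powersetCard (Fin n) r :=
    (show IncTuple n r ≃ (Fin r ↪o Fin n) from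
      { toFun := fun v => OrderEmbedding.ofStrictMono v.idx v.2
        invFun := fun f => ⟨toLex f, f.strictMono⟩
        left_inv := fun _ => rfl
        right_inv := fun _ => rfl }).trans Set.powersetCard.ofFinEmbEquiv
  rw [← Nat.card_eq_fintype_card, Nat.card_congr e, Set.powersetCard.card, Nat.card_eq_fintype_card,
    Fintype.card_fin]

/-- The enumeration of `𝓘_{n,r}` in lexicographic order. -/
def lexTuple (n r : ℕ) : Fin (n.choose r) ≃o IncTuple n r :=
  monoEquivOfFin (IncTuple n r) (card_incTuple n r)

/-- The `r`-th multiplicative compound matrix `X_[r]`: its `(i, j)` entry is `det X_{I,J}`, where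
`I` and `J` are the `i`-th and `j`-th increasing `r`-tuples in lexicographic order. -/
def compound {p q : ℕ} (X : Matrix (Fin p) (Fin q) ℝ) (r : ℕ) :
    Matrix (Fin (p.choose r)) (Fin (q.choose r)) ℝ :=
  Matrix.of fun i j => (X.submatrix (lexTuple p r i).idx (lexTuple q r j).idx).det

/-- The only position `Fin (r choose r)` of a row (column) of an `r`-th compound matrix of a matrix
with `r` rows (columns). -/
def onlyIdx (r : ℕ) : Fin (r.choose r) := ⟨0, by simp⟩

/-- `(M 0)`: the matrix `M` padded by zero columns on the right to a matrix with `q` columns. -/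
def padZeroCols {d p : ℕ} (q : ℕ) (M : Matrix (Fin d) (Fin p) ℝ) : Matrix (Fin d) (Fin q) ℝ :=
  Matrix.of fun i j => if h : (j : ℕ) < p then M i ⟨j, h⟩ else 0

/-- The matrix `(0 ; I_m)` with `n` rows and `m` columns, whose last `m` rows form the identity
matrix and whose first `n - m` rows are zero (for `m ≤ n`). -/
def bottomId (n m : ℕ) : Matrix (Fin n) (Fin m) ℝ :=
  Matrix.of fun i j => if (i : ℕ) = (n - m) + (j : ℕ) then 1 else 0

/-- As a subset of `{1, 2, …}`, the increasing `k`-tuple `γ` is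
`{1, …, k - r} ∪ {s, …, s + r - 1}`. -/
def IsInitBlock {N k : ℕ} (r s : ℕ) (γ : IncTuple N k) : Prop :=
  Set.range (fun i : Fin k => (γ.idx i : ℕ) + 1) = Set.Icc 1 (k - r) ∪ Set.Icc s (s + r - 1)

/-! ### Sign variation -/

/-- The variation of a vector: the number of sign changes after deletion of the zero entries, i.e.
the number of pairs `i < j` of nonzero entries that become adjacent when the zeros are deleted and
that have opposite signs; the variation of the zero vector is `-1`. -/
def vari {n : ℕ} (u : Fin n → ℝ) : ℤ :=
  open Classical in
  if u = 0 then -1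
  else ((Finset.univ.filter fun p : Fin n × Fin n =>
    p.1 < p.2 ∧ (∀ l, p.1 < l → l < p.2 → u l = 0) ∧ u p.1 * u p.2 < 0).card : ℤ)

/-- The strict variation of a sequence: the largest (possibly infinite) number of sign changes
`z i * z (i + 1) < 0` of a sequence `z` obtained from `y` by replacing the zero entries by
arbitrary reals. -/
def variz (y : ℕ → ℝ) : ℕ∞ :=
  ⨆ z : {z : ℕ → ℝ // ∀ i, y i ≠ 0 → z i = y i}, {i : ℕ | z.1 i * z.1 (i + 1) < 0}.encard

/-- A linear map from vectors to sequences is strictly `k`-variation bounding. -/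
def IsSVB {n : ℕ} (k : ℕ) (X : (Fin n → ℝ) →ₗ[ℝ] (ℕ → ℝ)) : Prop :=
  ∀ u : Fin n → ℝ, u ≠ 0 → vari u ≤ (k : ℤ) → variz (X u) ≤ (k : ℕ∞)

/-! ### Linear time-invariant systems -/

/-- The observability operator `(𝒪(A,c) x₀)(t) = c Aᵗ x₀`, `t ≥ 0`. -/
def obsOp {n : ℕ} (A : Matrix (Fin n) (Fin n) ℝ) (c : Fin n → ℝ) :
    (Fin n → ℝ) →ₗ[ℝ] (ℕ → ℝ) where
  toFun x t := c ⬝ᵥ ((A ^ t) *ᵥ x)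
  map_add' x y := by
    funext t
    simp [Matrix.mulVec_add, dotProduct_add]
  map_smul' a x := by
    funext t
    simp [Matrix.mulVec_smul, dotProduct_smul]

/-- The truncated observability matrix `𝒪ᴺ(A,c)` with rows `c, cA, …, cA^{N-1}`. -/
def obsMat {n : ℕ} (A : Matrix (Fin n) (Fin n) ℝ) (c : Fin n → ℝ) (N : ℕ) :
    Matrix (Fin N) (Fin n) ℝ :=
  Matrix.of fun t => c ᵥ* (A ^ (t : ℕ))

/-- The pair `(A,c)` is observable: the observability matrix `𝒪ⁿ(A,c)` has rank `n`. -/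
def IsObservable {n : ℕ} (A : Matrix (Fin n) (Fin n) ℝ) (c : Fin n → ℝ) : Prop :=
  (obsMat A c n).rank = n

/-- The impulse response `g(t) = c A^{t-1} b`, `t ≥ 1`, of the system `(A,b,c)`. -/
def impulseResponse {d : ℕ} (A : Matrix (Fin d) (Fin d) ℝ) (b c : Fin d → ℝ) (t : ℕ) : ℝ :=
  c ⬝ᵥ ((A ^ (t - 1)) *ᵥ b)

/-- The system `(A,b,c)` is strictly externally positive. -/
def StrictlyExtPos {d : ℕ} (A : Matrix (Fin d) (Fin d) ℝ) (b c : Fin d → ℝ) : Prop :=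
  ∀ t : ℕ, 1 ≤ t → 0 < impulseResponse A b c t

/-- The system `(A,b,c)` is strictly externally negative. -/
def StrictlyExtNeg {d : ℕ} (A : Matrix (Fin d) (Fin d) ℝ) (b c : Fin d → ℝ) : Prop :=
  ∀ t : ℕ, 1 ≤ t → impulseResponse A b c t < 0

/-! ### The compound systems -/

/-- `Ã_r = A_[r]`. -/
def compA {n : ℕ} (A : Matrix (Fin n) (Fin n) ℝ) (r : ℕ) :
    Matrix (Fin (n.choose r)) (Fin (n.choose r)) ℝ :=
  compound A r

/-- The row vector `c̃_r = (𝒪ʳ)_[r]`. -/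
def compC {n : ℕ} (A : Matrix (Fin n) (Fin n) ℝ) (c : Fin n → ℝ) (r : ℕ) :
    Fin (n.choose r) → ℝ :=
  fun j => compound (obsMat A c r) r (onlyIdx r) j

/-- `P_β = I_{(1:n),β}`. -/
def selCols {n k : ℕ} (β : IncTuple n k) : Matrix (Fin n) (Fin k) ℝ :=
  (1 : Matrix (Fin n) (Fin n) ℝ).submatrix id β.idx

/-- The column vector
`b̃_{k,r,β} = ((A^{k-r} (𝒪ⁿ)⁻¹ (0 ; I_{n-k+r}))_[r]  0) (𝒪ⁿ P_β)_[k]`. -/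
def compB {n k : ℕ} (A : Matrix (Fin n) (Fin n) ℝ) (c : Fin n → ℝ) (r : ℕ) (β : IncTuple n k) :
    Fin (n.choose r) → ℝ :=
  fun i =>
    (padZeroCols (n.choose k)
        (compound (A ^ (k - r) * (obsMat A c n)⁻¹ * bottomId n (n - k + r)) r)
      * compound (obsMat A c n * selCols β) k) i (onlyIdx k)

/-- The column index sets to be tested: `β = {1, …, k - r'} ∪ {t', …, t' + r' - 1}` with
`1 ≤ r' ≤ k` and `k - r' + 1 ≤ t' ≤ n - r' + 1`. -/
def IsTestTuple {n k : ℕ} (β : IncTuple n k) : Prop :=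
  ∃ r' t' : ℕ, 1 ≤ r' ∧ r' ≤ k ∧ k - r' + 1 ≤ t' ∧ t' ≤ n - r' + 1 ∧ IsInitBlock r' t' β

end

/-!
Write `𝒪` for the infinite observability matrix with rows `c Aᵗ`, `t ≥ 0`.

The minors of `𝒪` with rows `(1:k-r) ∪ (k-r+t:k+t-1)` are evaluated by factoring these rows as
`Z 𝒪ⁿ`, where `Z` is their product with `(𝒪ⁿ)⁻¹`. The first `k - r` rows of `Z` are unit vectors, so
its nonzero maximal minors are those whose columns contain `1, …, k - r`; in the lexicographic order
these come first, and they are the maximal minors of the lower right block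
`𝒪ʳ A^{t-1} A^{k-r} (𝒪ⁿ)⁻¹ (0 ; I)` (`det_submatrix_lexTuple`). The Cauchy–Binet formula
`det_mul_eq_sum_incTuple`, used for the determinant and for the multiplicativity of compounds, turns
the minor into the impulse response of the compound system
(`det_obsMat_submatrix_initBlockTuple`).

The variation bounding property is first translated into sign consistency: an operator is strictly
`k - 1`-variation bounding if and only if all minors of order `k` of its matrix have the same strict
sign (`isSVB_iff_sign_consistent`). The main tool is the linear relation between `k + 1` vectors of
`ℝᵏ` whose coefficients are the alternating maximal minors. If a minor vanishes, or if two minors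
differing by the exchange of one row or one column have opposite signs, it yields a vector of
variation less than `k` whose image has `k` zeros or alternates in sign `k` times; and any two minors
are connected by such exchanges. Conversely, a vector of variation less than `k` is constant in sign
on `k` consecutive blocks of indices; adding up the columns over the blocks preserves the sign of
the minors, and then the alternating relation excludes an image alternating `k` times.

Finally, the signs of all minors of order `k` are determined by the test minors. This is a
statement about the maximal minors of a matrix with `k` columns (`minorPos_of_initBlock`), applied to
the rows and then to the columns (`obsRows_sign_consistent`). It follows by induction from the
three-term Plücker relation `p(T,a,c) p(T,b,d) = p(T,a,b) p(T,c,d) + p(T,a,d) p(T,b,c)`, in which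
`p(T,b,d)` is positive as soon as the other five minors are.
-/

noncomputable section

/-! ### The Cauchy–Binet formula and compound matrices -/

theorem IncTuple.strictMono {n r : ℕ} (v : IncTuple n r) : StrictMono v.idx := v.2

/-- The increasing tuple with a given strictly increasing index function. -/
def IncTuple.ofStrictMono {n r : ℕ} (f : Fin r → Fin n) (hf : StrictMono f) : IncTuple n r :=
  ⟨toLex f, hf⟩

@[simp] theorem IncTuple.idx_ofStrictMono {n r : ℕ} (f : Fin r → Fin n) (hf : StrictMono f) :
    (IncTuple.ofStrictMono f hf).idx = f := rfl

theorem IncTuple.idx_injective {n r : ℕ} :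
    Function.Injective (IncTuple.idx : IncTuple n r → Fin r → Fin n) :=
  fun _ _ h => Subtype.ext (ofLex.injective h)

/-- Expansion of `det (A * B)` by multilinearity in the rows of the product. -/
theorem det_mul_eq_sum_prod_mul_det {r n : ℕ} (A : Matrix (Fin r) (Fin n) ℝ)
    (B : Matrix (Fin n) (Fin r) ℝ) :
    (A * B).det = ∑ f : Fin r → Fin n, (∏ i, A i (f i)) * (B.submatrix f id).det := by
  have h := (detRowAlternating (R := ℝ) (n := Fin r)).toMultilinearMap.map_sum
    (fun (i : Fin r) (j : Fin n) => A i j • B j)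
  have hrow : (fun i => ∑ j, A i j • B j) = A * B := by
    funext i l
    simp [Matrix.mul_apply]
  rw [hrow] at h
  refine h.trans (Finset.sum_congr rfl fun f _ => ?_)
  rw [MultilinearMap.map_smul_univ, smul_eq_mul]
  rfl

theorem IncTuple.comp_perm_injective {r n : ℕ} :
    Function.Injective
      (fun x : IncTuple n r × Equiv.Perm (Fin r) => (x.1.idx ∘ x.2 : Fin r → Fin n)) := by
  rintro ⟨J, σ⟩ ⟨J', σ'⟩ h
  simp only at h
  have hr : Set.range J.idx = Set.range J'.idx := by
    rw [← σ.surjective.range_comp, h, σ'.surjective.range_comp]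
  have hJ : J = J' := IncTuple.idx_injective ((J.strictMono.range_inj J'.strictMono).1 hr)
  subst hJ
  have hσ : σ = σ' := Equiv.ext fun i => J.strictMono.injective (congrFun h i)
  rw [hσ]

/-- Every injective tuple is a rearrangement of an increasing one. -/
theorem exists_incTuple_comp_perm {r n : ℕ} {f : Fin r → Fin n} (hf : Function.Injective f) :
    ∃ (J : IncTuple n r) (σ : Equiv.Perm (Fin r)), J.idx ∘ σ = f := by
  refine ⟨IncTuple.ofStrictMono (f ∘ Tuple.sort f) ((Tuple.monotone_sort f).strictMono_of_injective
    (hf.comp (Tuple.sort f).injective)), (Tuple.sort f)⁻¹, ?_⟩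
  funext i
  simp

/-- The **Cauchy–Binet formula**. -/
theorem det_mul_eq_sum_incTuple {r n : ℕ} (A : Matrix (Fin r) (Fin n) ℝ)
    (B : Matrix (Fin n) (Fin r) ℝ) :
    (A * B).det = ∑ J : IncTuple n r, (A.submatrix id J.idx).det * (B.submatrix J.idx id).det := by
  rw [det_mul_eq_sum_prod_mul_det]
  have h1 : ∑ x : IncTuple n r × Equiv.Perm (Fin r),
      (∏ i, A i (x.1.idx (x.2 i))) * (B.submatrix (x.1.idx ∘ x.2) id).det
      = ∑ f : Fin r → Fin n, (∏ i, A i (f i)) * (B.submatrix f id).det := by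
    refine Finset.sum_of_injOn (fun x => x.1.idx ∘ x.2)
      IncTuple.comp_perm_injective.injOn (by simp [Set.MapsTo]) ?_ (fun _ _ => rfl)
    intro f _ hf
    -- a non-injective tuple repeats a row of `B`
    have hninj : ¬ Function.Injective f := by
      intro hinj
      obtain ⟨J, σ, h⟩ := exists_incTuple_comp_perm hinj
      exact hf ⟨(J, σ), by simp, h⟩
    obtain ⟨i, j, hij, hne⟩ : ∃ i j, f i = f j ∧ i ≠ j := by
      simpa [Function.Injective] using hninj
    rw [Matrix.det_zero_of_row_eq hne (by funext l; simp [hij]), mul_zero]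
  rw [← h1, Fintype.sum_prod_type]
  refine Finset.sum_congr rfl fun J _ => ?_
  rw [← Matrix.det_transpose (A.submatrix id J.idx), Matrix.det_apply', Finset.sum_mul]
  refine Finset.sum_congr rfl fun σ _ => ?_
  have h2 : (B.submatrix (J.idx ∘ σ) id).det
      = (Equiv.Perm.sign σ : ℤ) * (B.submatrix J.idx id).det := by
    rw [← Matrix.det_permute]
    rfl
  rw [h2]
  simp only [transpose_apply, submatrix_apply, id]
  ring

theorem compound_mul {p q s : ℕ} (X : Matrix (Fin p) (Fin q) ℝ) (Y : Matrix (Fin q) (Fin s) ℝ)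
    (r : ℕ) : compound (X * Y) r = compound X r * compound Y r := by
  ext i j
  rw [Matrix.mul_apply]
  simp only [compound, Matrix.of_apply]
  rw [← Matrix.submatrix_mul_equiv X Y (lexTuple p r i).idx (Equiv.refl _) (lexTuple s r j).idx,
    det_mul_eq_sum_incTuple, ← (lexTuple q r).toEquiv.sum_comp]
  rfl

theorem compound_pow_mul {p q : ℕ} (A : Matrix (Fin p) (Fin p) ℝ) (Y : Matrix (Fin p) (Fin q) ℝ)
    (r t : ℕ) : compound A r ^ t * compound Y r = compound (A ^ t * Y) r := by
  induction t with
  | zero => simp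
  | succ t ih => rw [pow_succ', pow_succ', Matrix.mul_assoc, ih, ← compound_mul, Matrix.mul_assoc]

theorem mul_padZeroCols {e d p q : ℕ} (B : Matrix (Fin e) (Fin d) ℝ)
    (M : Matrix (Fin d) (Fin p) ℝ) : B * padZeroCols q M = padZeroCols q (B * M) := by
  ext i j
  by_cases h : (j : ℕ) < p <;> simp [padZeroCols, Matrix.mul_apply, h]

theorem lexTuple_onlyIdx (r : ℕ) : (lexTuple r r (onlyIdx r)).idx = id := by
  have h := (lexTuple r r (onlyIdx r)).strictMono
  refine (h.range_inj strictMono_id).1 ?_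
  rw [Set.range_id, (Finite.injective_iff_surjective.1 h.injective).range_eq]

/-! ### Initial tuples in the lexicographic enumeration -/

/-- The tuple `(1:m) ∪ (m + v)`, obtained from `v` by shifting by `m` and prepending `1, …, m`. -/
def prependInit {m r p : ℕ} (v : IncTuple p r) : IncTuple (m + p) (m + r) :=
  IncTuple.ofStrictMono (Fin.append (Fin.castAdd p) (Fin.natAdd m ∘ v.idx)) (by
    intro i j hij
    induction i using Fin.addCases with
    | left i =>
      induction j using Fin.addCases with
      | left j =>
        simp only [Fin.lt_def, Fin.val_castAdd] at hij
        simpa only [Fin.append_left, Fin.lt_def, Fin.val_castAdd] using hij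
      | right j =>
        simp only [Fin.append_left, Fin.append_right, Fin.lt_def, Fin.val_castAdd,
          Function.comp, Fin.val_natAdd]
        omega
    | right i =>
      induction j using Fin.addCases with
      | left j =>
        simp only [Fin.lt_def, Fin.val_castAdd, Fin.val_natAdd] at hij
        omega
      | right j =>
        simp only [Fin.lt_def, Fin.val_natAdd] at hij
        have := v.strictMono (a := i) (b := j) (by rw [Fin.lt_def]; omega)
        simp only [Fin.append_right, Function.comp, Fin.lt_def, Fin.val_natAdd] at this ⊢
        omega)

theorem prependInit_idx {m r p : ℕ} (v : IncTuple p r) :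
    (prependInit (m := m) v).idx = Fin.append (Fin.castAdd p) (Fin.natAdd m ∘ v.idx) := rfl

theorem incTuple_lt_iff {n r : ℕ} (v w : IncTuple n r) :
    v < w ↔ ∃ i, (∀ j < i, v.idx j = w.idx j) ∧ v.idx i < w.idx i := Iff.rfl

theorem prependInit_strictMono {m r p : ℕ} :
    StrictMono (prependInit : IncTuple p r → IncTuple (m + p) (m + r)) := by
  intro v w h
  rw [incTuple_lt_iff] at h ⊢
  obtain ⟨i, hi, hlt⟩ := h
  refine ⟨Fin.natAdd m i, fun j hj => ?_, ?_⟩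
  · induction j using Fin.addCases with
    | left j => simp [prependInit_idx]
    | right j =>
      simp only [Fin.lt_def, Fin.val_natAdd] at hj
      simp [prependInit_idx, hi j (by rw [Fin.lt_def]; omega)]
  · simp only [prependInit_idx, Fin.append_right, Function.comp, Fin.lt_def, Fin.val_natAdd] at hlt ⊢
    omega

theorem exists_prependInit_eq {m r p : ℕ} (w : IncTuple (m + p) (m + r))
    (hw : ∀ j : Fin m, w.idx (Fin.castAdd r j) = Fin.castAdd p j) :
    ∃ v : IncTuple p r, prependInit v = w := by
  have hge : ∀ j : Fin r, m ≤ (w.idx (Fin.natAdd m j) : ℕ) := by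
    intro j
    by_contra! hlt
    have h1 := hw ⟨_, hlt⟩
    have h2 := w.strictMono.injective (h1.trans (b := _) (c := w.idx (Fin.natAdd m j)) (Fin.ext rfl))
    have h3 := congrArg Fin.val h2
    simp only [Fin.castAdd_mk, Fin.val_natAdd] at h3
    omega
  refine ⟨IncTuple.ofStrictMono (fun j => ⟨(w.idx (Fin.natAdd m j) : ℕ) - m, ?_⟩) ?_, ?_⟩
  · have := (w.idx (Fin.natAdd m j)).2
    have := hge j
    omega
  · intro i j hij
    have h1 : w.idx (Fin.natAdd m i) < w.idx (Fin.natAdd m j) :=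
      w.strictMono (by
        simp only [Fin.lt_def, Fin.val_natAdd] at hij ⊢
        omega)
    have := hge i
    simp only [Fin.lt_def] at h1 ⊢
    omega
  · apply IncTuple.idx_injective
    funext i
    rw [prependInit_idx]
    induction i using Fin.addCases with
    | left j => simp [hw]
    | right j =>
      apply Fin.ext
      have := hge j
      rw [Fin.append_right]
      change m + ((w.idx (Fin.natAdd m j) : ℕ) - m) = _
      omega

theorem IncTuple.le_idx {n r : ℕ} (w : IncTuple n r) (i : Fin r) : (i : ℕ) ≤ (w.idx i : ℕ) := by
  obtain ⟨i, hi⟩ := i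
  induction i with
  | zero => simp
  | succ i ih =>
    have h1 := ih (by omega)
    have h2 : w.idx ⟨i, by omega⟩ < w.idx ⟨i + 1, hi⟩ := w.strictMono (by simp [Fin.lt_def])
    simp only [Fin.lt_def] at h1 h2 ⊢
    omega

/-- The tuples beginning with `1, …, m` form an initial segment of the lexicographic order. -/
def prependInitSeg (m r p : ℕ) : IncTuple p r ≤i IncTuple (m + p) (m + r) where
  toRelEmbedding := (OrderEmbedding.ofStrictMono prependInit prependInit_strictMono).ltEmbedding
  mem_range_of_rel' v w h := by
    replace h : w < prependInit v := h
    rw [incTuple_lt_iff] at h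
    obtain ⟨i, hi, hlt⟩ := h
    refine exists_prependInit_eq w fun j => ?_
    induction i using Fin.addCases with
    | left i =>
      have h1 := w.le_idx (Fin.castAdd r i)
      simp only [prependInit_idx, Fin.append_left, Fin.lt_def, Fin.val_castAdd] at hlt h1
      omega
    | right i =>
      rw [hi _ (by simp only [Fin.lt_def, Fin.val_castAdd, Fin.val_natAdd]; omega), prependInit_idx]
      simp

/-- `Fin.castLE` as an initial segment. -/
def finCastLESeg {a b : ℕ} (h : a ≤ b) : Fin a ≤i Fin b where
  toRelEmbedding := (Fin.castLEOrderEmb h).ltEmbedding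
  mem_range_of_rel' i j hj := by
    replace hj : j < Fin.castLE h i := hj
    exact ⟨⟨j, lt_of_lt_of_le hj i.2.le⟩, Fin.ext rfl⟩

theorem choose_le_choose_add (m r p : ℕ) : p.choose r ≤ (m + p).choose (m + r) := by
  rw [← card_incTuple, ← card_incTuple]
  exact Fintype.card_le_of_injective _ (prependInit_strictMono (m := m)).injective

/-- In lexicographic order, the tuples of `𝓘_{m+p,m+r}` beginning with `1, …, m` come first, in the
order given by their remaining entries. -/
theorem lexTuple_castLE (m r p : ℕ) (j : Fin (p.choose r)) :
    lexTuple (m + p) (m + r) (Fin.castLE (choose_le_choose_add m r p) j)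
      = prependInit (lexTuple p r j) :=
  InitialSeg.eq ((finCastLESeg (choose_le_choose_add m r p)).trans
    (lexTuple (m + p) (m + r)).toInitialSeg)
    ((lexTuple p r).toInitialSeg.trans (prependInitSeg m r p)) j

/-- The maximal minors of a matrix whose first `m` rows are `(I_m 0)`, in lexicographic order: they
are minors of the lower right block, followed by zeros. -/
theorem det_submatrix_lexTuple {m r p : ℕ} (Z : Matrix (Fin (m + r)) (Fin (m + p)) ℝ)
    (hZ : ∀ (i : Fin m) (j : Fin (m + p)),
      Z (Fin.castAdd r i) j = if j = Fin.castAdd p i then 1 else 0)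
    (j : Fin ((m + p).choose (m + r))) :
    (Z.submatrix id (lexTuple (m + p) (m + r) j).idx).det =
      if h : (j : ℕ) < p.choose r then
        (Z.submatrix (Fin.natAdd m) (Fin.natAdd m ∘ (lexTuple p r ⟨j, h⟩).idx)).det else 0 := by
  split_ifs with h
  · have hj : j = Fin.castLE (choose_le_choose_add m r p) ⟨j, h⟩ := Fin.ext rfl
    conv_lhs => rw [hj, lexTuple_castLE]
    rw [← Matrix.det_submatrix_equiv_self finSumFinEquiv]
    have hblock : (Z.submatrix id (prependInit (m := m) (lexTuple p r ⟨j, h⟩)).idx).submatrix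
        finSumFinEquiv finSumFinEquiv = Matrix.fromBlocks 1 0
          (Z.submatrix (Fin.natAdd m) (Fin.castAdd p))
          (Z.submatrix (Fin.natAdd m) (Fin.natAdd m ∘ (lexTuple p r ⟨j, h⟩).idx)) := by
      ext a b
      rcases a with a | a <;> rcases b with b | b
      · simp [prependInit_idx, hZ, Matrix.one_apply, eq_comm]
      · have : (Fin.natAdd m ((lexTuple p r ⟨j, h⟩).idx b)) ≠ Fin.castAdd p a := by
          intro h
          have := congrArg Fin.val h
          simp only [Fin.val_natAdd, Fin.val_castAdd] at this
          omega
        simp [prependInit_idx, hZ, this]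
      · simp [prependInit_idx]
      · simp [prependInit_idx]
    rw [hblock, Matrix.det_fromBlocks_zero₁₂, Matrix.det_one, one_mul]
  · -- some entry `i < m` is missing from the tuple, and the corresponding row vanishes
    set w := lexTuple (m + p) (m + r) j with hw
    have hne : ∃ i : Fin m, w.idx (Fin.castAdd r i) ≠ Fin.castAdd p i := by
      by_contra! hall
      obtain ⟨v, hv⟩ := exists_prependInit_eq w hall
      obtain ⟨j', rfl⟩ := (lexTuple p r).surjective v
      rw [← lexTuple_castLE, hw] at hv
      have := (lexTuple (m + p) (m + r)).injective hv
      exact h (by rw [← this]; exact j'.2)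
    obtain ⟨i, hi⟩ := hne
    refine Matrix.det_eq_zero_of_row_eq_zero (Fin.castAdd r (WellFounded.min wellFounded_lt
      {i : Fin m | w.idx (Fin.castAdd r i) ≠ Fin.castAdd p i} ⟨i, hi⟩)) fun l => ?_
    set i₀ := WellFounded.min wellFounded_lt
      {i : Fin m | w.idx (Fin.castAdd r i) ≠ Fin.castAdd p i} ⟨i, hi⟩ with hi₀
    have h0 : w.idx (Fin.castAdd r i₀) ≠ Fin.castAdd p i₀ :=
      WellFounded.min_mem wellFounded_lt
        {i : Fin m | w.idx (Fin.castAdd r i) ≠ Fin.castAdd p i} ⟨i, hi⟩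
    have hlt : ∀ i < i₀, w.idx (Fin.castAdd r i) = Fin.castAdd p i := by
      intro i hii
      by_contra hcon
      exact WellFounded.not_lt_min wellFounded_lt
        {i : Fin m | w.idx (Fin.castAdd r i) ≠ Fin.castAdd p i} hcon hii
    have h1 : (i₀ : ℕ) < w.idx (Fin.castAdd r i₀) := by
      refine lt_of_le_of_ne (by simpa using w.le_idx (Fin.castAdd r i₀)) fun h => h0 (Fin.ext ?_)
      simp [← h]
    have h2 : w.idx l ≠ Fin.castAdd p i₀ := by
      intro hl
      rcases lt_or_ge l (Fin.castAdd r i₀) with hlt' | hge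
      · have hlm : (l : ℕ) < i₀ := by simpa [Fin.lt_def] using hlt'
        have h3 := hlt ⟨l, hlm.trans i₀.2⟩ (by simpa [Fin.lt_def] using hlm)
        have h4 : Fin.castAdd r (⟨l, hlm.trans i₀.2⟩ : Fin m) = l := Fin.ext rfl
        rw [h4, hl] at h3
        have := congrArg Fin.val h3
        simp only [Fin.val_castAdd] at this
        omega
      · have h3 := w.strictMono.monotone hge
        rw [hl] at h3
        simp only [Fin.le_def, Fin.val_castAdd] at h3
        omega
    simp [hZ, h2]

/-! ### Minors of the observability matrix as impulse responses -/

theorem isUnit_obsMat {n : ℕ} {A : Matrix (Fin n) (Fin n) ℝ} {c : Fin n → ℝ}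
    (h : IsObservable A c) : IsUnit (obsMat A c n).det := by
  rw [← Matrix.isUnit_iff_isUnit_det, ← Matrix.linearIndependent_rows_iff_isUnit,
    linearIndependent_iff_card_eq_finrank_span, Set.finrank, ← Matrix.rank_eq_finrank_span_row]
  simpa using h.symm

/-- The tuple `(1:m) ∪ (m+s+1:m+s+r)`. -/
def initBlockTuple {N m r : ℕ} (s : ℕ) (h : s + (m + r) ≤ N) : IncTuple N (m + r) :=
  IncTuple.ofStrictMono (fun i => ⟨if (i : ℕ) < m then i else i + s, by split_ifs <;> omega⟩) (by
    intro i j hij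
    simp only [Fin.lt_def] at hij ⊢
    split_ifs <;> omega)

theorem initBlockTuple_idx_val {N m r s : ℕ} (h : s + (m + r) ≤ N) (i : Fin (m + r)) :
    ((initBlockTuple (m := m) (r := r) s h).idx i : ℕ) = if (i : ℕ) < m then (i : ℕ) else i + s :=
  rfl

theorem isInitBlock_initBlockTuple {N m r s : ℕ} (h : s + (m + r) ≤ N) (hr : 1 ≤ r) :
    IsInitBlock r (m + (s + 1)) (initBlockTuple (m := m) (r := r) s h) := by
  unfold IsInitBlock
  ext x
  simp only [initBlockTuple_idx_val, Set.mem_range, Set.mem_union, Set.mem_Icc]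
  constructor
  · rintro ⟨i, rfl⟩
    have := i.2
    split_ifs <;> omega
  · rintro (⟨h1, h2⟩ | ⟨h1, h2⟩)
    · exact ⟨⟨x - 1, by omega⟩, by simp only; split_ifs <;> omega⟩
    · exact ⟨⟨x - 1 - s, by omega⟩, by simp only; split_ifs <;> omega⟩

theorem impulseResponse_comp {n k : ℕ} (A : Matrix (Fin n) (Fin n) ℝ) (c : Fin n → ℝ)
    (r : ℕ) (β : IncTuple n k) (t : ℕ) :
    impulseResponse (compA A r) (compB A c r β) (compC A c r) t =
      ∑ j : Fin (n.choose k), padZeroCols (n.choose k) (compound (obsMat A c r *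
        (A ^ (t - 1) * (A ^ (k - r) * (obsMat A c n)⁻¹ * bottomId n (n - k + r)))) r)
          (onlyIdx r) j * compound (obsMat A c n * selCols β) k j (onlyIdx k) := by
  have h : impulseResponse (compA A r) (compB A c r β) (compC A c r) t =
      (compound (obsMat A c r) r * (compound A r ^ (t - 1) * (padZeroCols (n.choose k)
        (compound (A ^ (k - r) * (obsMat A c n)⁻¹ * bottomId n (n - k + r)) r)
      * compound (obsMat A c n * selCols β) k))) (onlyIdx r) (onlyIdx k) := rfl
  rw [h, ← Matrix.mul_assoc, ← Matrix.mul_assoc, Matrix.mul_assoc (compound (obsMat A c r) r),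
    mul_padZeroCols, mul_padZeroCols, compound_pow_mul, ← compound_mul, Matrix.mul_apply]

theorem obsMat_apply {n : ℕ} (A : Matrix (Fin n) (Fin n) ℝ) (c : Fin n → ℝ) (N : ℕ) (t : Fin N) :
    obsMat A c N t = c ᵥ* (A ^ (t : ℕ)) := rfl

theorem obsMat_mul_pow_apply {n : ℕ} (A : Matrix (Fin n) (Fin n) ℝ) (c : Fin n → ℝ) (N s : ℕ)
    (t : Fin N) : (obsMat A c N * A ^ s) t = c ᵥ* (A ^ ((t : ℕ) + s)) := by
  rw [pow_add, ← Matrix.vecMul_vecMul, ← obsMat_apply A c N t]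
  rfl

/-- The minors of the observability matrix with an initial block of rows are impulse responses of
the compound systems: writing `𝒪ᴺ_α = Z 𝒪ⁿ`, the first rows of `Z` are unit vectors, so that the
maximal minors of `Z` are those of its lower right block, and Cauchy–Binet applies. -/
theorem det_obsMat_submatrix_initBlockTuple {n : ℕ} (A : Matrix (Fin n) (Fin n) ℝ) (c : Fin n → ℝ)
    (hobs : IsObservable A c) {m r N s : ℕ} (hn : m + r ≤ n) (β : IncTuple n (m + r))
    (h : s + (m + r) ≤ N) :
    ((obsMat A c N).submatrix (initBlockTuple (m := m) (r := r) s h).idx β.idx).det =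
      impulseResponse (compA A r) (compB A c r β) (compC A c r) (s + 1) := by
  obtain ⟨l, rfl⟩ : ∃ l, n = m + (l + r) := ⟨n - (m + r), by omega⟩
  set α := (initBlockTuple (m := m) (r := r) s h).idx with hα
  set O := obsMat A c (m + (l + r)) with hO
  have hOu : IsUnit O.det := isUnit_obsMat hobs
  set Z : Matrix (Fin (m + r)) (Fin (m + (l + r))) ℝ := (obsMat A c N).submatrix α id * O⁻¹ with hZ
  have hfact : (obsMat A c N).submatrix α β.idx = Z * (O * selCols β) := by
    rw [hZ, Matrix.mul_assoc, ← Matrix.mul_assoc O⁻¹, Matrix.nonsing_inv_mul _ hOu, Matrix.one_mul,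
      selCols]
    ext i j
    simp [Matrix.mul_apply, Matrix.one_apply]
  have hZ1 : ∀ (i : Fin m) (j : Fin (m + (l + r))),
      Z (Fin.castAdd r i) j = if j = Fin.castAdd (l + r) i then 1 else 0 := by
    intro i j
    have hrow : Z (Fin.castAdd r i) = (O * O⁻¹) (Fin.castAdd (l + r) i) := by
      rw [hZ, Matrix.mul_apply_eq_vecMul, Matrix.mul_apply_eq_vecMul]
      congr 1
      funext l
      simp only [Matrix.submatrix_apply, id, hO, obsMat_apply, hα, initBlockTuple_idx_val,
        Fin.val_castAdd, if_pos i.2]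
    rw [hrow, Matrix.mul_nonsing_inv _ hOu, Matrix.one_apply]
    simp only [eq_comm]
  have hp : m + (l + r) - (m + r) + r = l + r := by omega
  have hm : m + r - r = m := by omega
  rw [hfact, det_mul_eq_sum_incTuple, impulseResponse_comp, hp, hm,
    ← (lexTuple (m + (l + r)) (m + r)).toEquiv.sum_comp]
  refine Finset.sum_congr rfl fun j _ => ?_
  have hY : compound (O * selCols β) (m + r) j (onlyIdx (m + r))
      = ((O * selCols β).submatrix (lexTuple (m + (l + r)) (m + r) j).idx id).det := by
    simp only [compound, Matrix.of_apply, lexTuple_onlyIdx]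
  have hQ := det_submatrix_lexTuple Z hZ1 j
  rw [hY]
  refine congrArg₂ _ (hQ.trans ?_) rfl
  simp only [padZeroCols, Matrix.of_apply]
  refine dite_congr rfl (fun hj => ?_) (fun _ => rfl)
  simp only [compound, Matrix.of_apply, lexTuple_onlyIdx]
  congr 1
  ext a b
  have hcol : ∀ W : Matrix (Fin r) (Fin (m + (l + r))) ℝ, ∀ b' : Fin (l + r),
      (W * bottomId (m + (l + r)) (l + r)) a b' = W a (Fin.natAdd m b') := by
    intro W b'
    rw [Matrix.mul_apply, Finset.sum_eq_single (Fin.natAdd m b')]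
    · simp [bottomId]
    · intro x _ hx
      have : (x : ℕ) ≠ m + (b' : ℕ) := fun h => hx (Fin.ext (by simpa using h))
      simp [bottomId, this]
    · simp
  simp only [Matrix.submatrix_apply, id, Function.comp]
  rw [← Matrix.mul_assoc, ← Matrix.mul_assoc, hcol, ← Matrix.mul_assoc,
    Matrix.mul_assoc (obsMat A c r), ← pow_add, Nat.add_sub_cancel]
  have hrow : Z (Fin.natAdd m a) = (obsMat A c r * A ^ (s + m) * O⁻¹) a := by
    rw [hZ, Matrix.mul_apply_eq_vecMul, Matrix.mul_apply_eq_vecMul, obsMat_mul_pow_apply]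
    congr 1
    have : m + (a : ℕ) + s = a + (s + m) := by omega
    funext l
    simp only [Matrix.submatrix_apply, id, obsMat_apply, hα, initBlockTuple_idx_val,
      Fin.val_natAdd, if_neg (Nat.not_lt.2 (Nat.le_add_right m a)), this]
  rw [hrow]

/-! ### Relations between maximal minors -/

/-- The linear relation between `k + 1` vectors of `ℝᵏ` whose coefficients are the alternating
maximal minors. -/
theorem sum_alternating_minor_mul {k : ℕ} (V : Matrix (Fin (k + 1)) (Fin k) ℝ) (l : Fin k) :
    ∑ j : Fin (k + 1), (-1) ^ (j : ℕ) * (V.submatrix j.succAbove id).det * V j l = 0 := by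
  have h : (Matrix.of fun i => (Fin.cons (V i l) (V i) : Fin (k + 1) → ℝ)).det = 0 :=
    Matrix.det_zero_of_column_eq (i := 0) (j := l.succ) (Fin.succ_ne_zero l).symm (by simp)
  rw [Matrix.det_succ_column_zero] at h
  rw [← h]
  refine Finset.sum_congr rfl fun j _ => ?_
  have : ((Matrix.of fun i => (Fin.cons (V i l) (V i) : Fin (k + 1) → ℝ)).submatrix j.succAbove
      Fin.succ) = V.submatrix j.succAbove id := by
    ext a b
    simp
  rw [this]
  simp only [Matrix.of_apply, Fin.cons_zero]
  ring

/-- The relation between the rows `f`, evaluated under the linear functional taking a row to the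
determinant formed by this row followed by the rows `g`. -/
theorem sum_alternating_minor_mul_det {ι : Type*} {k : ℕ} (V : Matrix ι (Fin (k + 1)) ℝ)
    (f : Fin (k + 2) → ι) (g : Fin k → ι) :
    ∑ j : Fin (k + 2), (-1) ^ (j : ℕ) * (V.submatrix (f ∘ j.succAbove) id).det *
      (V.submatrix (Fin.cons (f j) g : Fin (k + 1) → ι) id).det = 0 := by
  have hexp : ∀ x : ι, (V.submatrix (Fin.cons x g : Fin (k + 1) → ι) id).det =
      ∑ l : Fin (k + 1), V x l * ((-1) ^ (l : ℕ) * (V.submatrix g l.succAbove).det) := by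
    intro x
    rw [Matrix.det_succ_row_zero]
    refine Finset.sum_congr rfl fun l _ => ?_
    have : (V.submatrix (Fin.cons x g : Fin (k + 1) → ι) id).submatrix Fin.succ l.succAbove
        = V.submatrix g l.succAbove := by
      ext a b
      simp
    rw [this]
    simp only [Matrix.submatrix_apply, Fin.cons_zero, id]
    ring
  simp only [hexp, Finset.mul_sum]
  rw [Finset.sum_comm]
  refine Finset.sum_eq_zero fun l _ => ?_
  have h := sum_alternating_minor_mul (V.submatrix f id) l
  have h2 := congrArg (· * ((-1) ^ (l : ℕ) * (V.submatrix g l.succAbove).det)) h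
  simp only [zero_mul, Finset.sum_mul] at h2
  rw [← h2]
  refine Finset.sum_congr rfl fun j _ => ?_
  simp only [Matrix.submatrix_submatrix, Matrix.submatrix_apply, id]
  change _ * (V.submatrix (f ∘ j.succAbove) id).det * _ =
    _ * (V.submatrix (f ∘ j.succAbove) id).det * _ * _
  ring

/-- The three-term Plücker relation. -/
theorem det_plucker {ι : Type*} {m : ℕ} (V : Matrix ι (Fin (m + 2)) ℝ) (T : Fin m → ι)
    (a b c d : ι) :
    let q : ι → ι → ℝ := fun x y =>
      (V.submatrix (Fin.cons x (Fin.cons y T) : Fin (m + 2) → ι) id).det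
    q a c * q b d = q a b * q c d + q a d * q b c := by
  intro q
  have h := sum_alternating_minor_mul_det V
    (Fin.cons a (Fin.cons b (Fin.cons c T)) : Fin (m + 3) → ι) (Fin.cons d T : Fin (m + 1) → ι)
  rw [Fin.sum_univ_succ, Fin.sum_univ_succ, Fin.sum_univ_succ] at h
  have hzero : ∀ i : Fin m, (V.submatrix (Fin.cons (T i) (Fin.cons d T) : Fin (m + 2) → ι) id).det
      = 0 := fun i => Matrix.det_zero_of_row_eq (i := 0) (j := i.succ.succ)
    (Fin.succ_ne_zero _).symm (by funext l; simp)
  have e0 : (Fin.cons a (Fin.cons b (Fin.cons c T)) : Fin (m + 3) → ι) ∘ (0 : Fin (m + 3)).succAbove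
      = (Fin.cons b (Fin.cons c T) : Fin (m + 2) → ι) := by
    funext i
    simp
  have e1 : (Fin.cons a (Fin.cons b (Fin.cons c T)) : Fin (m + 3) → ι) ∘
      (Fin.succ 0 : Fin (m + 3)).succAbove = (Fin.cons a (Fin.cons c T) : Fin (m + 2) → ι) := by
    funext i
    refine Fin.cases ?_ (fun i => ?_) i <;> simp
  have e2 : (Fin.cons a (Fin.cons b (Fin.cons c T)) : Fin (m + 3) → ι) ∘
      (Fin.succ (Fin.succ 0) : Fin (m + 3)).succAbove
      = (Fin.cons a (Fin.cons b T) : Fin (m + 2) → ι) := by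
    funext i
    refine Fin.cases ?_ (fun i => Fin.cases ?_ (fun i => ?_) i) i <;>
      simp only [Function.comp, Fin.succ_succAbove_zero, Fin.succ_succAbove_succ, Fin.cons_zero,
        Fin.cons_succ, Fin.succAbove_zero]
  rw [e0, e1, e2] at h
  simp only [Fin.cons_zero, Fin.cons_succ, hzero, mul_zero, Finset.sum_const_zero,
    add_zero, Fin.val_zero, Fin.val_succ] at h
  simp only [q]
  linear_combination -h

/-! ### A criterion for all maximal minors to have the same strict sign -/

/-- The minor of the rows `f`, with a sign making it independent of the order of the rows (the sign
of the Vandermonde determinant of `f`). -/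
def orderFreeMinor {k : ℕ} (V : Matrix ℕ (Fin k) ℝ) (f : Fin k → ℕ) : ℝ :=
  (V.submatrix f id).det * (Matrix.vandermonde fun i => (f i : ℝ)).det

theorem orderFreeMinor_comp_perm {k : ℕ} (V : Matrix ℕ (Fin k) ℝ) (f : Fin k → ℕ)
    (σ : Equiv.Perm (Fin k)) : orderFreeMinor V (f ∘ σ) = orderFreeMinor V f := by
  have h1 : (V.submatrix (f ∘ σ) id).det = (Equiv.Perm.sign σ : ℤ) * (V.submatrix f id).det := by
    rw [← Matrix.det_permute]
    rfl
  have h2 : (Matrix.vandermonde fun i => (((f ∘ σ) i : ℕ) : ℝ)).det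
      = (Equiv.Perm.sign σ : ℤ) * (Matrix.vandermonde fun i => (f i : ℝ)).det := by
    rw [← Matrix.det_permute]
    rfl
  have h3 : ((Equiv.Perm.sign σ : ℤ) : ℝ) * ((Equiv.Perm.sign σ : ℤ) : ℝ) = 1 := by
    rw [← Int.cast_mul, Int.units_coe_mul_self, Int.cast_one]
  rw [orderFreeMinor, orderFreeMinor, h1, h2]
  linear_combination (V.submatrix f id).det * (Matrix.vandermonde fun i => (f i : ℝ)).det * h3

theorem det_vandermonde_pos {k : ℕ} {f : Fin k → ℕ} (hf : StrictMono f) :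
    0 < (Matrix.vandermonde fun i => (f i : ℝ)).det := by
  rw [Matrix.det_vandermonde]
  refine Finset.prod_pos fun i _ => Finset.prod_pos fun j hj => ?_
  have : (f i : ℝ) < f j := by exact_mod_cast hf (Finset.mem_Ioi.1 hj)
  linarith

theorem det_vandermonde_cons {k : ℕ} (x : ℝ) (g : Fin k → ℝ) :
    (Matrix.vandermonde (Fin.cons x g : Fin (k + 1) → ℝ)).det
      = (∏ i, (g i - x)) * (Matrix.vandermonde g).det := by
  rw [Matrix.det_vandermonde, Matrix.det_vandermonde, Fin.prod_univ_succ]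
  simp

theorem orderFreeMinor_cons_cons {m : ℕ} (V : Matrix ℕ (Fin (m + 2)) ℝ) (T : Fin m → ℕ)
    (x y : ℕ) :
    orderFreeMinor V (Fin.cons x (Fin.cons y T) : Fin (m + 2) → ℕ) =
      (V.submatrix (Fin.cons x (Fin.cons y T) : Fin (m + 2) → ℕ) id).det *
        (((y : ℝ) - x) * (∏ i, ((T i : ℝ) - x)) *
          ((∏ i, ((T i : ℝ) - y)) * (Matrix.vandermonde fun i => (T i : ℝ)).det)) := by
  have h : (fun i => ((Fin.cons x (Fin.cons y T) : Fin (m + 2) → ℕ) i : ℝ))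
      = Fin.cons (x : ℝ) (Fin.cons (y : ℝ) fun i => (T i : ℝ)) := by
    funext i
    refine Fin.cases ?_ (fun i => Fin.cases ?_ (fun i => ?_) i) i <;> simp
  rw [orderFreeMinor, h, det_vandermonde_cons, det_vandermonde_cons, Fin.prod_univ_succ]
  simp

/-- The maximal minor of `V` with rows `S` (in increasing order) has the strict sign of `σ`. The
condition is void unless `S` has `k` elements. -/
def MinorPos {k : ℕ} (σ : ℝ) (V : Matrix ℕ (Fin k) ℝ) (S : Finset ℕ) : Prop :=
  ∀ f : Fin k → ℕ, StrictMono f → Set.range f = S → 0 < σ * (V.submatrix f id).det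

theorem MinorPos.orderFreeMinor_pos {k : ℕ} {σ : ℝ} {V : Matrix ℕ (Fin k) ℝ} {S : Finset ℕ}
    (h : MinorPos σ V S) {f : Fin k → ℕ} (hf : Function.Injective f) (hS : Set.range f = S) :
    0 < σ * orderFreeMinor V f := by
  have hmono : StrictMono (f ∘ Tuple.sort f) :=
    (Tuple.monotone_sort f).strictMono_of_injective (hf.comp (Tuple.sort f).injective)
  have h1 := h _ hmono (by rw [(Tuple.sort f).surjective.range_comp, hS])
  rw [← orderFreeMinor_comp_perm V f (Tuple.sort f), orderFreeMinor, ← mul_assoc]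
  exact mul_pos h1 (det_vandermonde_pos hmono)

theorem minorPos_of_orderFreeMinor_pos {k : ℕ} {σ : ℝ} {V : Matrix ℕ (Fin k) ℝ} {S : Finset ℕ}
    {f : Fin k → ℕ} (hf : Function.Injective f) (hS : Set.range f = S)
    (h : 0 < σ * orderFreeMinor V f) : MinorPos σ V S := by
  intro g hg hgS
  have hmono : StrictMono (f ∘ Tuple.sort f) :=
    (Tuple.monotone_sort f).strictMono_of_injective (hf.comp (Tuple.sort f).injective)
  have hfg : f ∘ Tuple.sort f = g :=
    (hmono.range_inj hg).1 (by rw [(Tuple.sort f).surjective.range_comp, hS, hgS])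
  rw [← orderFreeMinor_comp_perm V f (Tuple.sort f), hfg, orderFreeMinor, ← mul_assoc] at h
  exact (pos_iff_pos_of_mul_pos h).2 (det_vandermonde_pos hg)

/-- Five of the six minors in a three-term Plücker relation being positive, so is the sixth one,
as `p(T,a,c) p(T,b,d) = p(T,a,b) p(T,c,d) + p(T,a,d) p(T,b,c)`. -/
theorem MinorPos.plucker {k : ℕ} {σ : ℝ} {V : Matrix ℕ (Fin k) ℝ} {T : Finset ℕ}
    (hT : T.card + 2 = k) {a b c d : ℕ} (hab : a < b) (hbc : b < c) (hcd : c < d)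
    (ha : a ∉ T) (hb : b ∉ T) (hc : c ∉ T) (hd : d ∉ T)
    (hpac : MinorPos σ V (insert a (insert c T))) (hpab : MinorPos σ V (insert a (insert b T)))
    (hpcd : MinorPos σ V (insert c (insert d T))) (hpad : MinorPos σ V (insert a (insert d T)))
    (hpbc : MinorPos σ V (insert b (insert c T))) : MinorPos σ V (insert b (insert d T)) := by
  subst hT
  set t : Fin T.card → ℕ := ⇑(T.orderEmbOfFin rfl) with ht
  have htr : Set.range t = T := Finset.range_orderEmbOfFin T rfl
  have htinj : Function.Injective t := (T.orderEmbOfFin rfl).injective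
  have hrange : ∀ x y : ℕ, Set.range (Fin.cons x (Fin.cons y t) : Fin (T.card + 2) → ℕ)
      = ((insert x (insert y T) : Finset ℕ) : Set ℕ) := by
    intro x y
    rw [Fin.range_cons, Fin.range_cons, htr]
    simp
  have hinj : ∀ x y : ℕ, x < y → x ∉ T → y ∉ T →
      Function.Injective (Fin.cons x (Fin.cons y t) : Fin (T.card + 2) → ℕ) := by
    intro x y hxy hx hy
    have hmem : ∀ z, z ∈ Set.range t ↔ z ∈ T := fun z => by rw [htr, Finset.mem_coe]
    rw [Fin.cons_injective_iff, Fin.cons_injective_iff, Fin.range_cons, Set.mem_insert_iff,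
      hmem, hmem]
    exact ⟨by simp [hx, hxy.ne], hy, htinj⟩
  have key := det_plucker V t a b c d
  simp only at key
  have kac := hpac.orderFreeMinor_pos (hinj a c (hab.trans hbc) ha hc) (hrange a c)
  have kab := hpab.orderFreeMinor_pos (hinj a b hab ha hb) (hrange a b)
  have kcd := hpcd.orderFreeMinor_pos (hinj c d hcd hc hd) (hrange c d)
  have kad := hpad.orderFreeMinor_pos (hinj a d (hab.trans (hbc.trans hcd)) ha hd) (hrange a d)
  have kbc := hpbc.orderFreeMinor_pos (hinj b c hbc hb hc) (hrange b c)
  refine minorPos_of_orderFreeMinor_pos (hinj b d (hbc.trans hcd) hb hd) (hrange b d) ?_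
  rw [orderFreeMinor_cons_cons] at kac kab kcd kad kbc ⊢
  have cast_pos : ∀ {x y : ℕ}, x < y → (0 : ℝ) < (y : ℝ) - x := fun h => by
    have : (_ : ℝ) < _ := Nat.cast_lt (α := ℝ).2 h
    linarith
  have pac := cast_pos (hab.trans hbc)
  have pab := cast_pos hab
  have pcd := cast_pos hcd
  have pad := cast_pos (hab.trans (hbc.trans hcd))
  have pbc := cast_pos hbc
  have pbd := cast_pos (hbc.trans hcd)
  generalize (V.submatrix (Fin.cons a (Fin.cons c t) : Fin (T.card + 2) → ℕ) id).det = qac at *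
  generalize (V.submatrix (Fin.cons a (Fin.cons b t) : Fin (T.card + 2) → ℕ) id).det = qab at *
  generalize (V.submatrix (Fin.cons a (Fin.cons d t) : Fin (T.card + 2) → ℕ) id).det = qad at *
  generalize (V.submatrix (Fin.cons b (Fin.cons c t) : Fin (T.card + 2) → ℕ) id).det = qbc at *
  generalize (V.submatrix (Fin.cons b (Fin.cons d t) : Fin (T.card + 2) → ℕ) id).det = qbd at *
  generalize (V.submatrix (Fin.cons c (Fin.cons d t) : Fin (T.card + 2) → ℕ) id).det = qcd at *
  generalize ∏ i, ((t i : ℝ) - a) = wa at *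
  generalize ∏ i, ((t i : ℝ) - b) = wb at *
  generalize ∏ i, ((t i : ℝ) - c) = wc at *
  generalize ∏ i, ((t i : ℝ) - d) = wd at *
  generalize (Matrix.vandermonde fun i => (t i : ℝ)).det = τ at *
  have strip : ∀ {q x u v : ℝ}, 0 < x → 0 < σ * (q * (x * u * v)) → 0 < σ * (q * u * v) := by
    intro q x u v hx h
    have : σ * (q * (x * u * v)) = (σ * (q * u * v)) * x := by ring
    rw [this] at h
    exact (pos_iff_pos_of_mul_pos h).2 hx
  have sac := strip pac kac
  have sab := strip pab kab
  have scd := strip pcd kcd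
  have sad := strip pad kad
  have sbc := strip pbc kbc
  have hprod : (σ * (qac * wa * (wc * τ))) * (σ * (qbd * wb * (wd * τ)))
      = (σ * (qab * wa * (wb * τ))) * (σ * (qcd * wc * (wd * τ)))
        + (σ * (qad * wa * (wd * τ))) * (σ * (qbc * wb * (wc * τ))) := by
    linear_combination σ ^ 2 * wa * wb * wc * wd * τ ^ 2 * key
  have hpos : 0 < (σ * (qac * wa * (wc * τ))) * (σ * (qbd * wb * (wd * τ))) := by
    rw [hprod]
    exact add_pos (mul_pos sab scd) (mul_pos sad sbc)
  have sbd := (pos_iff_pos_of_mul_pos hpos).1 sac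
  have : σ * (qbd * ((↑d - ↑b) * wb * (wd * τ))) = (σ * (qbd * wb * (wd * τ))) * (↑d - ↑b) := by
    ring
  rw [this]
  exact mul_pos sbd pbd

/-- If the maximal minors of `V` with rows `(1:k-r) ∪ (s:s+r-1)` all have the strict sign of `σ`,
then so do all maximal minors: induction on the number of rows after an initial block `1, …, a`,
then on the spread of these rows, by a three-term Plücker relation involving the missing row
`a + 1`. -/
theorem minorPos_of_initBlock {k N : ℕ} (hk : 1 ≤ k) {σ : ℝ} {V : Matrix ℕ (Fin k) ℝ}
    (h : ∀ r s, 1 ≤ r → r ≤ k → k - r ≤ s → s + r ≤ N →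
      MinorPos σ V (Finset.range (k - r) ∪ Finset.Ico s (s + r)))
    {S : Finset ℕ} (hS : S ⊆ Finset.range N) (hcard : S.card = k) : MinorPos σ V S := by
  suffices H : ∀ r ≤ k, ∀ S : Finset ℕ, S ⊆ Finset.range N → S.card = k →
      Finset.range (k - r) ⊆ S → MinorPos σ V S from H k le_rfl S hS hcard (by simp)
  clear hS hcard S
  intro r
  induction r with
  | zero =>
    intro _ S hS hcard hsub
    have hSeq : Finset.range k = S := Finset.eq_of_subset_of_card_le hsub (by simp [hcard])
    have hkN : k ≤ N := by simpa [hcard] using Finset.card_le_card hS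
    have := h 1 (k - 1) le_rfl hk le_rfl (by omega)
    have he : Finset.range (k - 1) ∪ Finset.Ico (k - 1) (k - 1 + 1) = S := by
      rw [← hSeq]
      ext x
      simp only [Finset.mem_union, Finset.mem_range, Finset.mem_Ico]
      omega
    rwa [he] at this
  | succ r ih =>
    intro hr
    suffices H : ∀ d s : ℕ, ∀ S : Finset ℕ, S ⊆ Finset.range N → S.card = k →
        Finset.range (k - (r + 1)) ⊆ S → k - (r + 1) ≤ s →
        (∀ x ∈ S, k - (r + 1) ≤ x → s ≤ x ∧ x < s + d) → MinorPos σ V S by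
      intro S hS hcard hsub
      refine H N (k - (r + 1)) S hS hcard hsub le_rfl fun x hx hx' => ⟨hx', ?_⟩
      have := Finset.mem_range.1 (hS hx)
      omega
    set a := k - (r + 1) with ha
    have har : a + 1 = k - r := by omega
    have hak : a + (r + 1) = k := by omega
    intro d
    induction d with
    | zero =>
      intro s S hS hcard hsub _ hbd
      exfalso
      have : S ⊆ Finset.range a := fun x hx => by
        rw [Finset.mem_range]
        by_contra hlt
        have := hbd x hx (by omega)
        omega
      have := Finset.card_le_card this
      rw [Finset.card_range] at this
      omega
    | succ d ihd =>
      intro s S hS hcard hsub has hbd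
      by_cases haS : a ∈ S
      · refine ih (by omega) S hS hcard ?_
        rw [← har, Finset.range_add_one]
        exact Finset.insert_subset haS hsub
      by_cases hsS : s ∈ S
      swap
      · refine ihd (s + 1) S hS hcard hsub (by omega) fun x hx hx' => ?_
        have := hbd x hx hx'
        have : x ≠ s := fun h => hsS (h ▸ hx)
        omega
      by_cases hdS : s + d ∈ S
      swap
      · refine ihd s S hS hcard hsub has fun x hx hx' => ?_
        have := hbd x hx hx'
        have : x ≠ s + d := fun h => hdS (h ▸ hx)
        omega
      have hsa : a < s := lt_of_le_of_ne has fun h => haS (h ▸ hsS)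
      have hunion : S ⊆ Finset.range a ∪ Finset.Ico s (s + (d + 1)) := fun x hx => by
        rw [Finset.mem_union, Finset.mem_range, Finset.mem_Ico]
        by_cases hxa : x < a
        · exact Or.inl hxa
        · exact Or.inr (hbd x hx (by omega))
      by_cases hgap : ∃ m, m ∈ Finset.Ico s (s + (d + 1)) ∧ m ∉ S
      swap
      · -- the rows after the initial block are consecutive
        push Not at hgap
        have hSeq : S = Finset.range a ∪ Finset.Ico s (s + (d + 1)) :=
          Finset.Subset.antisymm hunion (Finset.union_subset hsub hgap)
        have hdisj : Disjoint (Finset.range a) (Finset.Ico s (s + (d + 1))) := by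
          rw [Finset.disjoint_left]
          intro x hx hx'
          rw [Finset.mem_range] at hx
          rw [Finset.mem_Ico] at hx'
          omega
        have hc := hcard
        rw [hSeq, Finset.card_union_of_disjoint hdisj, Finset.card_range, Nat.card_Ico] at hc
        have hdr : d = r := by omega
        subst hdr
        have hsN := Finset.mem_range.1 (hS hdS)
        have := h (d + 1) s (by omega) hr has (by omega)
        rwa [← ha, ← hSeq] at this
      obtain ⟨m, hm, hmS⟩ := hgap
      rw [Finset.mem_Ico] at hm
      have hms : s < m := lt_of_le_of_ne hm.1 fun h => hmS (h ▸ hsS)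
      have hmd : m < s + d := lt_of_le_of_ne (by omega) fun h => hmS (h ▸ hdS)
      set T := (S.erase s).erase (s + d) with hT
      have hTmem : ∀ x, x ∈ T ↔ x ≠ s + d ∧ x ≠ s ∧ x ∈ S := fun x => by
        rw [hT, Finset.mem_erase, Finset.mem_erase]
      have hsT : s ∉ T := by simp [hTmem]
      have hdT : s + d ∉ T := by simp [hTmem]
      have haT : a ∉ T := by simp [hTmem, haS]
      have hmT : m ∉ T := by simp [hTmem, hmS]
      have hTcard : T.card + 2 = k := by
        have h1 := Finset.card_erase_add_one hsS
        have h2 := Finset.card_erase_add_one (a := s + d) (s := S.erase s)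
          (Finset.mem_erase.2 ⟨by omega, hdS⟩)
        rw [← hT] at h2
        omega
      have hSeq : insert s (insert (s + d) T) = S := by
        ext x
        simp only [Finset.mem_insert, hTmem]
        by_cases h1 : x = s
        · simp [h1, hsS]
        · by_cases h2 : x = s + d
          · simp [h2, hdS]
          · simp [h1, h2]
      have hTN : T ⊆ Finset.range N := fun x hx => hS ((hTmem x).1 hx).2.2
      have hsN := Finset.mem_range.1 (hS hdS)
      have hTa : Finset.range a ⊆ T := fun x hx => by
        have h1 := Finset.mem_range.1 hx
        exact (hTmem x).2 ⟨by omega, by omega, hsub hx⟩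
      have hcard2 : ∀ x y, x < y → x ∉ T → y ∉ T → (insert x (insert y T)).card = k := by
        intro x y hxy hx hy
        rw [Finset.card_insert_of_notMem (by simp [hx, hxy.ne]), Finset.card_insert_of_notMem hy]
        exact hTcard
      have hsubN : ∀ x y, x < N → y < N → insert x (insert y T) ⊆ Finset.range N := by
        intro x y hx hy
        exact Finset.insert_subset (Finset.mem_range.2 hx)
          (Finset.insert_subset (Finset.mem_range.2 hy) hTN)
      have hTsub : ∀ x y, T ⊆ insert x (insert y T) := fun x y =>
        (Finset.subset_insert _ _).trans (Finset.subset_insert _ _)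
      have hA : ∀ y, a < y → y < N → y ∉ T → MinorPos σ V (insert a (insert y T)) := by
        intro y hay hyN hyT
        refine ih (by omega) _ (hsubN a y (by omega) hyN) (hcard2 a y hay haT hyT) ?_
        rw [← har, Finset.range_add_one]
        exact Finset.insert_subset (Finset.mem_insert_self _ _) (hTa.trans (hTsub _ _))
      rw [← hSeq]
      refine MinorPos.plucker hTcard hsa hms hmd haT hsT hmT hdT (hA m (by omega) (by omega) hmT)
        (hA s (by omega) (by omega) hsT) ?_ (hA (s + d) (by omega) (by omega) hdT) ?_
      · refine ihd (s + 1) _ (hsubN _ _ (by omega) hsN) (hcard2 _ _ hmd hmT hdT)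
          (hTa.trans (hTsub _ _)) (by omega) fun x hx hx' => ?_
        rw [Finset.mem_insert, Finset.mem_insert, hTmem] at hx
        rcases hx with rfl | rfl | ⟨h1, h2, h3⟩
        · omega
        · omega
        · have := hbd x h3 hx'
          omega
      · refine ihd s _ (hsubN _ _ (by omega) (by omega)) (hcard2 _ _ hms hsT hmT)
          (hTa.trans (hTsub _ _)) has fun x hx hx' => ?_
        rw [Finset.mem_insert, Finset.mem_insert, hTmem] at hx
        rcases hx with rfl | rfl | ⟨h1, h2, h3⟩
        · omega
        · omega
        · have := hbd x h3 hx'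
          omega

/-! ### Strict variation of sequences -/

theorem exists_adjacent_sign_change {z : ℕ → ℝ} (hz : ∀ t, z t ≠ 0) {a b : ℕ} (hab : a < b)
    (h : z a * z b < 0) : ∃ e, a ≤ e ∧ e < b ∧ z e * z (e + 1) < 0 := by
  induction b, hab using Nat.le_induction with
  | base => exact ⟨a, le_rfl, Nat.lt_succ_self a, h⟩
  | succ b hab ih =>
    by_cases hb : z b * z (b + 1) < 0
    · exact ⟨b, (Nat.le_of_succ_le hab), Nat.lt_succ_self b, hb⟩
    · have hb' : 0 < z b * z (b + 1) := lt_of_le_of_ne (not_lt.1 hb)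
        (mul_ne_zero (hz _) (hz _)).symm
      have hneg : z a * z b < 0 := by
        have h1 : (z a * z b) * (z (b + 1) * z (b + 1)) < 0 := by
          have : (z a * z b) * (z (b + 1) * z (b + 1))
              = (z a * z (b + 1)) * (z b * z (b + 1)) := by ring
          rw [this]
          exact mul_neg_of_neg_of_pos h hb'
        exact neg_of_mul_neg_left h1 (mul_self_nonneg _)
      obtain ⟨e, h1, h2, h3⟩ := ih hneg
      exact ⟨e, h1, h2.trans (Nat.lt_succ_self b), h3⟩

/-- A sequence that weakly alternates in sign along `k + 1` positions has strict variation at least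
`k`. -/
theorem le_variz {y : ℕ → ℝ} {k : ℕ} {i : Fin (k + 1) → ℕ} (hi : StrictMono i) {σ : ℝ}
    (hσ : σ ≠ 0) (h : ∀ j : Fin (k + 1), 0 ≤ σ * (-1) ^ (j : ℕ) * y (i j)) : (k : ℕ∞) ≤ variz y := by
  classical
  set z : ℕ → ℝ := fun t => if y t ≠ 0 then y t else
    if h : ∃ j, i j = t then σ * (-1) ^ (h.choose : ℕ) else 1 with hz
  have hsq : ∀ j : ℕ, (σ * (-1) ^ j) * (σ * (-1) ^ j) = σ * σ := fun j => by
    have : ((-1 : ℝ) ^ j) * (-1) ^ j = 1 := by rw [← mul_pow]; simp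
    linear_combination σ * σ * this
  have hz0 : ∀ t, z t ≠ 0 := fun t => by
    simp only [hz]
    split_ifs with h1 h2
    · exact h1
    · exact mul_ne_zero hσ (pow_ne_zero _ (by norm_num))
    · exact one_ne_zero
  have hzpos : ∀ j : Fin (k + 1), 0 < σ * (-1) ^ (j : ℕ) * z (i j) := fun j => by
    by_cases h1 : y (i j) ≠ 0
    · have : z (i j) = y (i j) := by simp only [hz, if_pos h1]
      rw [this]
      exact lt_of_le_of_ne (h j)
        (mul_ne_zero (mul_ne_zero hσ (pow_ne_zero _ (by norm_num))) h1).symm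
    · have hex : ∃ j', i j' = i j := ⟨j, rfl⟩
      have : z (i j) = σ * (-1) ^ (j : ℕ) := by
        simp only [hz, if_neg h1, dif_pos hex]
        rw [hi.injective hex.choose_spec]
      rw [this, hsq]
      exact mul_self_pos.2 hσ
  have hneg : ∀ j : Fin k, z (i j.castSucc) * z (i j.succ) < 0 := fun j => by
    have h1 := mul_pos (hzpos j.castSucc) (hzpos j.succ)
    have h2 : (σ * (-1) ^ (j.castSucc : ℕ) * z (i j.castSucc)) *
        (σ * (-1) ^ (j.succ : ℕ) * z (i j.succ))
        = -(z (i j.castSucc) * z (i j.succ)) * (σ * σ) := by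
      rw [Fin.val_castSucc, Fin.val_succ, pow_succ, ← hsq j]
      ring
    rw [h2] at h1
    have := (pos_iff_pos_of_mul_pos h1).2 (mul_self_pos.2 hσ)
    linarith
  choose e he1 he2 he3 using fun j : Fin k =>
    exists_adjacent_sign_change hz0 (hi (Fin.castSucc_lt_succ (i := j))) (hneg j)
  have hemono : StrictMono e := by
    intro a b hab
    have : i a.succ ≤ i b.castSucc := hi.monotone (by
      simp only [Fin.lt_def, Fin.le_def, Fin.val_succ, Fin.val_castSucc] at hab ⊢
      omega)
    exact lt_of_lt_of_le (he2 a) (this.trans (he1 b))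
  have hcard : (k : ℕ∞) ≤ {t : ℕ | z t * z (t + 1) < 0}.encard := by
    have h1 : (Set.range e).encard = k := by
      rw [← Set.image_univ, hemono.injective.encard_image]
      simp
    rw [← h1]
    refine Set.encard_le_encard ?_
    rintro _ ⟨j, rfl⟩
    exact he3 j
  exact hcard.trans (le_iSup (fun z : {z : ℕ → ℝ // ∀ i, y i ≠ 0 → z i = y i} =>
    {i : ℕ | z.1 i * z.1 (i + 1) < 0}.encard)
    ⟨z, fun t ht => by simp only [hz, if_pos ht]⟩)

/-- From `p + 1` sign changes between consecutive entries one can extract `p + 2` entries with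
strictly alternating signs. -/
theorem exists_alternating {z : ℕ → ℝ} (p : ℕ) (S : Finset ℕ) (hcard : S.card = p + 1)
    (hS : ∀ e ∈ S, z e * z (e + 1) < 0) :
    ∃ i : Fin (p + 2) → ℕ, StrictMono i ∧ ∃ σ : ℝ,
      (∀ j : Fin (p + 2), 0 < σ * (-1) ^ (j : ℕ) * z (i j)) ∧
      ∃ x ∈ S, i (Fin.last _) ≤ x + 1 := by
  induction p generalizing S with
  | zero =>
    obtain ⟨e, rfl⟩ := Finset.card_eq_one.1 hcard
    have he := hS e (Finset.mem_singleton_self e)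
    refine ⟨![e, e + 1], ?_, z e, ?_, e, Finset.mem_singleton_self e, le_rfl⟩
    · rw [Fin.strictMono_iff_lt_succ]
      intro j
      fin_cases j
      simp
    · intro j
      fin_cases j
      · have : z e ≠ 0 := left_ne_zero_of_mul he.ne
        simpa using this
      · simp
        linarith
  | succ p ih =>
    have hne : S.Nonempty := Finset.card_pos.1 (by omega)
    set e := S.max' hne with he
    have heS : e ∈ S := S.max'_mem hne
    obtain ⟨i, hi, σ, hσ, x, hx, hxi⟩ := ih (S.erase e)
      (by rw [Finset.card_erase_of_mem heS, hcard]; rfl)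
      (fun t ht => hS t (Finset.mem_of_mem_erase ht))
    have hxe : x < e := lt_of_le_of_ne (S.le_max' x (Finset.mem_of_mem_erase hx))
      (Finset.ne_of_mem_erase hx)
    have hlast := hσ (Fin.last _)
    have hzl : z (i (Fin.last _)) ≠ 0 := fun h => by simp [h] at hlast
    have hzz := hS e heS
    -- the next entry is `e` or `e + 1`, according to the sign of the last one
    obtain ⟨e', h1, h2, h3⟩ : ∃ e', i (Fin.last _) < e' ∧ e' ≤ e + 1 ∧
        z (i (Fin.last _)) * z e' < 0 := by
      by_cases hc : z (i (Fin.last _)) * z e < 0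
      · refine ⟨e, lt_of_le_of_ne (hxi.trans hxe) ?_, Nat.le_succ e, hc⟩
        intro h
        rw [h] at hc
        exact absurd hc (not_lt.2 (mul_self_nonneg _))
      · refine ⟨e + 1, lt_of_le_of_lt hxi (by omega), le_rfl, ?_⟩
        have hpos : 0 < z (i (Fin.last _)) * z e := lt_of_le_of_ne (not_lt.1 hc)
          (mul_ne_zero hzl (left_ne_zero_of_mul hzz.ne)).symm
        have : (z (i (Fin.last _)) * z (e + 1)) * (z e * z e) < 0 := by
          have h : (z (i (Fin.last _)) * z (e + 1)) * (z e * z e)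
              = (z (i (Fin.last _)) * z e) * (z e * z (e + 1)) := by ring
          rw [h]
          exact mul_neg_of_pos_of_neg hpos hzz
        exact neg_of_mul_neg_left this (mul_self_nonneg _)
    refine ⟨Fin.snoc i e', ?_, σ, ?_, e, heS, by simpa using h2⟩
    · rw [Fin.strictMono_iff_lt_succ]
      intro j
      refine Fin.lastCases ?_ (fun j => ?_) j
      · rw [Fin.succ_last, Fin.snoc_last, Fin.snoc_castSucc]
        exact h1
      · rw [Fin.succ_castSucc, Fin.snoc_castSucc, Fin.snoc_castSucc]
        exact hi Fin.castSucc_lt_succ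
    · intro j
      refine Fin.lastCases ?_ (fun j => ?_) j
      · rw [Fin.snoc_last]
        have h4 : (σ * (-1) ^ (p + 1) * z (i (Fin.last _)))
            * (σ * (-1) ^ (p + 1) * z (i (Fin.last _))) * -(z (i (Fin.last _)) * z e')
            = (σ * (-1) ^ (p + 2) * z e') * ((σ * (-1) ^ (p + 1) * z (i (Fin.last _))) *
              (z (i (Fin.last _)) * z (i (Fin.last _)))) := by
          ring
        have h5 : 0 < (σ * (-1) ^ (p + 1) * z (i (Fin.last _))) := by simpa using hlast
        have h6 : 0 < (σ * (-1) ^ (p + 2) * z e') * ((σ * (-1) ^ (p + 1) * z (i (Fin.last _))) *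
              (z (i (Fin.last _)) * z (i (Fin.last _)))) := by
          rw [← h4]
          exact mul_pos (mul_pos h5 h5) (by linarith)
        simpa using (pos_iff_pos_of_mul_pos h6).2 (mul_pos h5 (mul_self_pos.2 hzl))
      · rw [Fin.snoc_castSucc]
        exact hσ j

/-- A sequence of strict variation greater than `m` weakly alternates in sign along `m + 2`
positions. -/
theorem exists_of_not_variz_le {y : ℕ → ℝ} {m : ℕ} (h : ¬ variz y ≤ m) :
    ∃ i : Fin (m + 2) → ℕ, StrictMono i ∧ ∃ σ : ℝ, σ ≠ 0 ∧
      ∀ j : Fin (m + 2), 0 ≤ σ * (-1) ^ (j : ℕ) * y (i j) := by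
  rw [variz, iSup_le_iff] at h
  push Not at h
  obtain ⟨⟨z, hz⟩, hlt⟩ := h
  simp only at hlt
  have hle : ((m + 1 : ℕ) : ℕ∞) ≤ {i : ℕ | z i * z (i + 1) < 0}.encard := by
    rw [Nat.cast_add, Nat.cast_one]
    exact Order.add_one_le_of_lt hlt
  obtain ⟨S, hSsub, hScard⟩ := Set.exists_subset_encard_eq hle
  have hfin : S.Finite := Set.finite_of_encard_eq_coe hScard
  obtain ⟨i, hi, σ, hσ, -⟩ := exists_alternating (z := z) m hfin.toFinset
    (by rw [hfin.encard_eq_coe_toFinset_card] at hScard; exact_mod_cast hScard)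
    (fun e he => hSsub (hfin.mem_toFinset.1 he))
  refine ⟨i, hi, σ, fun h0 => by simpa [h0] using hσ 0, fun j => ?_⟩
  by_cases hy : y (i j) = 0
  · simp [hy]
  · rw [← hz _ hy]
    exact (hσ j).le

/-! ### Variation of vectors -/

/-- The positions `q` of the nonzero entries of `u` whose sign is opposite to that of the previous
nonzero entry. -/
def signChangeEnds {n : ℕ} (u : Fin n → ℝ) : Finset (Fin n) :=
  open Classical in
  Finset.univ.filter fun q => ∃ p, p < q ∧ (∀ l, p < l → l < q → u l = 0) ∧ u p * u q < 0

theorem mem_signChangeEnds {n : ℕ} {u : Fin n → ℝ} {q : Fin n} : q ∈ signChangeEnds u ↔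
    ∃ p, p < q ∧ (∀ l, p < l → l < q → u l = 0) ∧ u p * u q < 0 := by
  simp [signChangeEnds]

theorem vari_eq_card_signChangeEnds {n : ℕ} {u : Fin n → ℝ} (hu : u ≠ 0) :
    vari u = (signChangeEnds u).card := by
  classical
  rw [vari, if_neg hu]
  congr 1
  refine Finset.card_bij (fun p _ => p.2) ?_ ?_ ?_
  · intro p hp
    exact mem_signChangeEnds.2 ⟨p.1, (Finset.mem_filter.1 hp).2⟩
  · rintro ⟨p, q⟩ hp ⟨p', q'⟩ hp' h
    obtain ⟨h1, h2, h3⟩ := (Finset.mem_filter.1 hp).2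
    obtain ⟨h1', h2', h3'⟩ := (Finset.mem_filter.1 hp').2
    simp only at h h1 h2 h3 h1' h2' h3'
    subst h
    rcases lt_trichotomy p p' with hlt | rfl | hlt
    · simp [h2 p' hlt h1'] at h3'
    · rfl
    · simp [h2' p hlt h1] at h3
  · intro q hq
    obtain ⟨p, hp⟩ := mem_signChangeEnds.1 hq
    exact ⟨(p, q), Finset.mem_filter.2 ⟨Finset.mem_univ _, hp⟩, rfl⟩

theorem vari_lt_card_of_support {n : ℕ} {u : Fin n → ℝ} (hu : u ≠ 0) {S : Finset (Fin n)}
    (hS : ∀ x, u x ≠ 0 → x ∈ S) : vari u < S.card := by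
  rw [vari_eq_card_signChangeEnds hu]
  have hne : (Finset.univ.filter fun x => u x ≠ 0).Nonempty := by
    obtain ⟨x, hx⟩ := Function.ne_iff.1 hu
    exact ⟨x, by simpa using hx⟩
  set x₀ := (Finset.univ.filter fun x => u x ≠ 0).min' hne with hx₀
  have hx₀S : u x₀ ≠ 0 := (Finset.mem_filter.1 (Finset.min'_mem _ hne)).2
  have hsub : signChangeEnds u ⊆ S.erase x₀ := by
    intro q hq
    obtain ⟨p, h1, -, h3⟩ := mem_signChangeEnds.1 hq
    refine Finset.mem_erase.2 ⟨?_, hS q (right_ne_zero_of_mul h3.ne)⟩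
    have : x₀ ≤ p := Finset.min'_le _ _ (by simpa using left_ne_zero_of_mul h3.ne)
    exact (lt_of_le_of_lt this h1).ne'
  have := Finset.card_le_card hsub
  rw [Finset.card_erase_of_mem (hS _ hx₀S)] at this
  have : 0 < S.card := Finset.card_pos.2 ⟨x₀, hS _ hx₀S⟩
  omega

/-- Two consecutive nonzero entries of equal sign improve the bound for the variation by one. -/
theorem vari_add_one_lt_card_of_support {n : ℕ} {u : Fin n → ℝ} {S : Finset (Fin n)}
    (hS : ∀ x, u x ≠ 0 → x ∈ S) {a b : Fin n} (hab : a < b)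
    (hgap : ∀ l, a < l → l < b → u l = 0) (hpos : 0 < u a * u b) : vari u + 1 < S.card := by
  have ha : u a ≠ 0 := left_ne_zero_of_mul hpos.ne'
  have hb : u b ≠ 0 := right_ne_zero_of_mul hpos.ne'
  have hu : u ≠ 0 := fun h => ha (by simp [h])
  rw [vari_eq_card_signChangeEnds hu]
  have hne : (Finset.univ.filter fun x => u x ≠ 0).Nonempty := ⟨a, by simpa using ha⟩
  set x₀ := (Finset.univ.filter fun x => u x ≠ 0).min' hne with hx₀
  have hx₀S : u x₀ ≠ 0 := (Finset.mem_filter.1 (Finset.min'_mem _ hne)).2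
  have hle : ∀ p, u p ≠ 0 → x₀ ≤ p := fun p hp => Finset.min'_le _ _ (by simpa using hp)
  have hbx : b ≠ x₀ := (lt_of_le_of_lt (hle a ha) hab).ne'
  have hsub : signChangeEnds u ⊆ (S.erase x₀).erase b := by
    intro q hq
    obtain ⟨p, h1, h2, h3⟩ := mem_signChangeEnds.1 hq
    have hp := left_ne_zero_of_mul h3.ne
    refine Finset.mem_erase.2 ⟨?_, Finset.mem_erase.2
      ⟨(lt_of_le_of_lt (hle p hp) h1).ne', hS q (right_ne_zero_of_mul h3.ne)⟩⟩
    rintro rfl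
    rcases lt_trichotomy p a with hlt | rfl | hlt
    · exact ha (h2 a hlt hab)
    · exact absurd h3 (not_lt.2 hpos.le)
    · exact hp (hgap p hlt h1)
  have h1 := Finset.card_le_card hsub
  have h2 := Finset.card_erase_add_one (hS _ hx₀S)
  have h3 := Finset.card_erase_add_one (s := S.erase x₀) (Finset.mem_erase.2 ⟨hbx, hS b hb⟩)
  omega

/-- Two entries of opposite sign enclose a sign change; `d` bounds their distance, on which the
proof goes by induction. -/
theorem exists_signChangeEnds_between {n : ℕ} {u : Fin n → ℝ} (d : ℕ) {x y : Fin n} (hxy : x < y)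
    (hd : (y : ℕ) ≤ x + d) (h : u x * u y < 0) : ∃ q ∈ signChangeEnds u, x < q ∧ q ≤ y := by
  induction d generalizing x y with
  | zero =>
    rw [Fin.lt_def] at hxy
    omega
  | succ d ih =>
    by_cases hgap : ∃ l, x < l ∧ l < y ∧ u l ≠ 0
    · obtain ⟨l, hl1, hl2, hl⟩ := hgap
      have hl1' := Fin.lt_def.1 hl1
      have hl2' := Fin.lt_def.1 hl2
      by_cases hxl : u x * u l < 0
      · obtain ⟨q, hq, h1, h2⟩ := ih hl1 (by omega) hxl
        exact ⟨q, hq, h1, h2.trans hl2.le⟩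
      · have hxl' : 0 < u x * u l := lt_of_le_of_ne (not_lt.1 hxl)
          (mul_ne_zero (left_ne_zero_of_mul h.ne) hl).symm
        have hly : u l * u y < 0 := by
          have h1 : (u l * u y) * (u x * u x) < 0 := by
            have : (u l * u y) * (u x * u x) = (u x * u l) * (u x * u y) := by ring
            rw [this]
            exact mul_neg_of_pos_of_neg hxl' h
          exact neg_of_mul_neg_left h1 (mul_self_nonneg _)
        obtain ⟨q, hq, h1, h2⟩ := ih hl2 (by omega) hly
        exact ⟨q, hq, hl1.trans h1, h2⟩
    · push Not at hgap
      exact ⟨y, mem_signChangeEnds.2 ⟨x, hxy, hgap, h⟩, hxy, le_rfl⟩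

/-- The index set of a vector of variation at most `m` is the disjoint union of `m + 1` nonempty
consecutive intervals on each of which the entries do not change sign. -/
theorem exists_monotone_block {n m : ℕ} (hmn : m + 1 ≤ n) {u : Fin n → ℝ} (hu : u ≠ 0)
    (hvar : vari u ≤ m) : ∃ b : Fin n → Fin (m + 1), Monotone b ∧ Function.Surjective b ∧
      ∀ x y, b x = b y → 0 ≤ u x * u y := by
  classical
  rw [vari_eq_card_signChangeEnds hu] at hvar
  -- the left end points of all blocks but the first one
  obtain ⟨D, hD1, hD2, hDcard⟩ := Finset.exists_subsuperset_card_eq (n := m)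
    (s := signChangeEnds u) (t := Finset.univ.erase (⟨0, by omega⟩ : Fin n))
    (fun q hq => by
      obtain ⟨p, hp, -⟩ := mem_signChangeEnds.1 hq
      refine Finset.mem_erase.2 ⟨?_, Finset.mem_univ _⟩
      rintro rfl
      simp [Fin.lt_def] at hp)
    (by exact_mod_cast hvar)
    (by rw [Finset.card_erase_of_mem (Finset.mem_univ _), Finset.card_univ, Fintype.card_fin]; omega)
  have hlt : ∀ x, (D.filter (· ≤ x)).card < m + 1 := fun x => by
    have := Finset.card_le_card (Finset.filter_subset (· ≤ x) D)
    omega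
  have hsame : ∀ x y, x < y → (D.filter (· ≤ x)).card = (D.filter (· ≤ y)).card →
      0 ≤ u x * u y := by
    intro x y hxy hcard
    by_contra! hneg
    obtain ⟨q, hq, h1, h2⟩ := exists_signChangeEnds_between y hxy (Nat.le_add_left _ _) hneg
    have hss : D.filter (· ≤ x) ⊂ D.filter (· ≤ y) := by
      refine (Finset.ssubset_iff_of_subset ?_).2 ⟨q, ?_, ?_⟩
      · exact Finset.monotone_filter_right D fun z _ hz => le_trans hz hxy.le
      · exact Finset.mem_filter.2 ⟨hD1 hq, h2⟩
      · simp [h1]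
    exact (Finset.card_lt_card hss).ne hcard
  refine ⟨fun x => ⟨(D.filter (· ≤ x)).card, hlt x⟩, ?_, ?_, ?_⟩
  · intro x y hxy
    exact Finset.card_le_card (Finset.monotone_filter_right D fun z _ hz => le_trans hz hxy)
  · intro c
    refine Fin.cases ⟨⟨0, by omega⟩, ?_⟩ (fun c => ⟨D.orderEmbOfFin hDcard c, ?_⟩) c
    · apply Fin.ext
      simp only [Fin.val_zero, Finset.card_eq_zero, Finset.filter_eq_empty_iff]
      intro x hx hx0
      have h1 := Finset.ne_of_mem_erase (hD2 hx)
      exact h1 (Fin.ext (Nat.le_zero.1 hx0))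
    · apply Fin.ext
      have : D.filter (· ≤ D.orderEmbOfFin hDcard c)
          = (Finset.Iic c).map (D.orderEmbOfFin hDcard).toEmbedding := by
        ext x
        simp only [Finset.mem_filter, Finset.mem_map, Finset.mem_Iic]
        constructor
        · rintro ⟨hx, hxc⟩
          have hr : x ∈ Set.range (D.orderEmbOfFin hDcard) := by
            rw [Finset.range_orderEmbOfFin]
            exact hx
          obtain ⟨c', rfl⟩ := hr
          exact ⟨c', (D.orderEmbOfFin hDcard).le_iff_le.1 hxc, rfl⟩
        · rintro ⟨c', hc', rfl⟩
          exact ⟨D.orderEmbOfFin_mem hDcard c', (D.orderEmbOfFin hDcard).le_iff_le.2 hc'⟩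
      simp only [this, Finset.card_map, Fin.card_Iic, Fin.val_succ]
  · intro x y hxy
    have hxy' := congrArg Fin.val hxy
    simp only at hxy'
    rcases lt_trichotomy x y with h | rfl | h
    · exact hsame x y h hxy'
    · exact mul_self_nonneg _
    · rw [mul_comm]
      exact hsame y x h hxy'.symm

/-! ### Strict sign consistency from the variation bounding property -/

theorem strictMono_snoc {k : ℕ} {f : Fin k → ℕ} (hf : StrictMono f) {t : ℕ} (h : ∀ i, f i < t) :
    StrictMono (Fin.snoc f t : Fin (k + 1) → ℕ) := by
  intro i j hij
  induction j using Fin.lastCases with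
  | last =>
    induction i using Fin.lastCases with
    | last => exact absurd hij (lt_irrefl _)
    | cast i => simpa using h i
  | cast j =>
    induction i using Fin.lastCases with
    | last => exact absurd (hij.trans (Fin.castSucc_lt_last j)) (lt_irrefl _)
    | cast i => simpa using hf (Fin.castSucc_lt_castSucc_iff.1 hij)

/-- A sequence with `k` zeros has strict variation at least `k`. -/
theorem le_variz_of_zeros {y : ℕ → ℝ} {k : ℕ} {α : Fin k → ℕ} (hα : StrictMono α)
    (h : ∀ i, y (α i) = 0) : (k : ℕ∞) ≤ variz y := by
  set t := (Finset.univ.sup α) + 1 with ht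
  have hlt : ∀ i, α i < t := fun i => Nat.lt_succ_of_le (Finset.le_sup (Finset.mem_univ i))
  have hsq : ((-1 : ℝ) ^ k) * (-1) ^ k = 1 := by rw [← mul_pow]; simp
  refine le_variz (strictMono_snoc hα hlt)
    (σ := (-1) ^ k * (if 0 ≤ y t then 1 else -1)) ?_ fun j => ?_
  · refine mul_ne_zero (pow_ne_zero _ (by norm_num)) ?_
    split_ifs <;> norm_num
  · induction j using Fin.lastCases with
    | last =>
      simp only [Fin.snoc_last, Fin.val_last]
      have : (-1 : ℝ) ^ k * (if 0 ≤ y t then 1 else -1) * (-1) ^ k * y t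
          = (if 0 ≤ y t then 1 else -1) * y t := by
        linear_combination (if 0 ≤ y t then (1 : ℝ) else -1) * y t * hsq
      rw [this]
      split_ifs with h0
      · simpa using h0
      · linarith [not_le.1 h0]
    | cast j => simp [h]

/-- A function of increasing tuples whose values on the `k`-element subtuples of any increasing
`k + 1`-tuple have equal strict signs has the same strict sign everywhere, as any two `k`-element
sets are connected by exchanges of single elements. -/
theorem mul_pos_of_exchange {ι : Type*} [LinearOrder ι] {k : ℕ} {F : (Fin k → ι) → ℝ}
    (h0 : ∀ f, StrictMono f → F f ≠ 0)
    (h : ∀ g : Fin (k + 1) → ι, StrictMono g → ∀ a b : Fin (k + 1),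
      0 < F (g ∘ a.succAbove) * F (g ∘ b.succAbove))
    {f f' : Fin k → ι} (hf : StrictMono f) (hf' : StrictMono f') : 0 < F f * F f' := by
  obtain ⟨d, hd⟩ : ∃ d, ((Finset.univ.image f) \ (Finset.univ.image f')).card = d := ⟨_, rfl⟩
  have hcard : ∀ {f : Fin k → ι}, StrictMono f → (Finset.univ.image f).card = k := fun hf => by
    rw [Finset.card_image_of_injective _ hf.injective, Finset.card_univ, Fintype.card_fin]
  induction d generalizing f with
  | zero =>
    have hsub : Finset.univ.image f ⊆ Finset.univ.image f' :=
      Finset.sdiff_eq_empty_iff_subset.1 (Finset.card_eq_zero.1 hd)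
    have heq := Finset.eq_of_subset_of_card_le hsub (by rw [hcard hf, hcard hf'])
    have : f = f' := (hf.range_inj hf').1
      (by simpa using congrArg (fun s : Finset ι => (s : Set ι)) heq)
    subst this
    exact mul_self_pos.2 (h0 f hf)
  | succ d ih =>
    obtain ⟨x, hx⟩ : ((Finset.univ.image f) \ (Finset.univ.image f')).Nonempty :=
      Finset.card_pos.1 (by omega)
    obtain ⟨y, hy⟩ : ((Finset.univ.image f') \ (Finset.univ.image f)).Nonempty := by
      have h1 := Finset.card_sdiff_add_card (Finset.univ.image f) (Finset.univ.image f')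
      have h2 := Finset.card_sdiff_add_card (Finset.univ.image f') (Finset.univ.image f)
      rw [hcard hf'] at h1
      rw [hcard hf, Finset.union_comm] at h2
      exact Finset.card_pos.1 (by omega)
    obtain ⟨hxf, hxf'⟩ := Finset.mem_sdiff.1 hx
    obtain ⟨hyf', hyf⟩ := Finset.mem_sdiff.1 hy
    have hU : (insert y (Finset.univ.image f)).card = k + 1 := by
      rw [Finset.card_insert_of_notMem hyf, hcard hf]
    set g := (insert y (Finset.univ.image f)).orderEmbOfFin hU with hg
    have hgr : Set.range g = ((insert y (Finset.univ.image f) : Finset ι) : Set ι) :=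
      Finset.range_orderEmbOfFin _ hU
    obtain ⟨a, ha⟩ : y ∈ Set.range g := by rw [hgr]; simp
    obtain ⟨b, hb⟩ : x ∈ Set.range g := by
      rw [hgr]
      exact Finset.mem_coe.2 (Finset.mem_insert_of_mem hxf)
    have hsucc : ∀ c : Fin (k + 1), Set.range (g ∘ c.succAbove)
        = ((insert y (Finset.univ.image f)).erase (g c) : Finset ι) := by
      intro c
      rw [Set.range_comp, Fin.range_succAbove, Set.compl_eq_univ_sdiff,
        Set.image_sdiff g.injective, Set.image_univ, hgr, Set.image_singleton, Finset.coe_erase]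
    have hmono : ∀ c : Fin (k + 1), StrictMono (g ∘ c.succAbove) := fun c =>
      g.strictMono.comp (Fin.strictMono_succAbove c)
    have hga : g ∘ a.succAbove = f := by
      refine ((hmono a).range_inj hf).1 ?_
      rw [hsucc, ha, Finset.erase_insert hyf]
      simp
    have h1 := h g g.strictMono a b
    rw [hga] at h1
    have himg : Finset.univ.image (g ∘ b.succAbove)
        = (insert y (Finset.univ.image f)).erase x := by
      have := hsucc b
      rw [hb] at this
      rw [← Finset.coe_inj, ← this, Finset.coe_image, Finset.coe_univ, Set.image_univ]
    have h2 := ih (hmono b) (by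
      have h3 : Finset.univ.image (g ∘ b.succAbove) \ Finset.univ.image f'
          = (Finset.univ.image f \ Finset.univ.image f').erase x := by
        rw [himg]
        ext z
        simp only [Finset.mem_sdiff, Finset.mem_erase, Finset.mem_insert]
        constructor
        · rintro ⟨⟨hzx, rfl | hz⟩, hz'⟩
          · exact absurd hyf' hz'
          · exact ⟨hzx, hz, hz'⟩
        · rintro ⟨hzx, hz, hz'⟩
          exact ⟨⟨hzx, Or.inr hz⟩, hz'⟩
      rw [h3, Finset.card_erase_of_mem hx, hd]
      rfl)
    have h3 : (F f * F f') * (F (g ∘ b.succAbove) * F (g ∘ b.succAbove))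
        = (F f * F (g ∘ b.succAbove)) * (F (g ∘ b.succAbove) * F f') := by ring
    have h4 := mul_pos h1 h2
    rw [← h3] at h4
    exact (pos_iff_pos_of_mul_pos h4).2 (mul_self_pos.2 (h0 _ (hmono b)))

theorem mul_pos_of_adjacent {k : ℕ} {m : Fin (k + 1) → ℝ} (h0 : ∀ j, m j ≠ 0)
    (h : ∀ j : Fin k, 0 < m j.castSucc * m j.succ) (a b : Fin (k + 1)) : 0 < m a * m b := by
  have hzero : ∀ a, 0 < m 0 * m a := by
    intro a
    induction a using Fin.induction with
    | zero => exact mul_self_pos.2 (h0 0)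
    | succ j ih =>
      have h1 := mul_pos ih (h j)
      have h2 : m 0 * m j.castSucc * (m j.castSucc * m j.succ)
          = m 0 * m j.succ * (m j.castSucc * m j.castSucc) := by ring
      rw [h2] at h1
      exact (pos_iff_pos_of_mul_pos h1).2 (mul_self_pos.2 (h0 _))
  have h1 := mul_pos (hzero a) (hzero b)
  have h2 : m 0 * m a * (m 0 * m b) = m a * m b * (m 0 * m 0) := by ring
  rw [h2] at h1
  exact (pos_iff_pos_of_mul_pos h1).2 (mul_self_pos.2 (h0 0))

theorem dotProduct_extend {n k : ℕ} {β : Fin k → Fin n} (hβ : Function.Injective β)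
    (w : Fin n → ℝ) (v : Fin k → ℝ) :
    w ⬝ᵥ Function.extend β v 0 = (w ∘ β) ⬝ᵥ v := by
  classical
  rw [dotProduct, dotProduct, ← Finset.sum_subset (Finset.subset_univ (Finset.univ.image β)),
    Finset.sum_image hβ.injOn]
  · simp [hβ.extend_apply]
  · intro x _ hx
    rw [Function.extend_apply' _ _ _ (by simpa using hx)]
    simp

theorem extend_ne_zero {n k : ℕ} {β : Fin k → Fin n} (hβ : Function.Injective β)
    {v : Fin k → ℝ} (hv : v ≠ 0) : Function.extend β v 0 ≠ 0 := by
  intro h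
  exact hv (funext fun i => by rw [← hβ.extend_apply v 0 i, h]; rfl)

theorem extend_support {n k : ℕ} {β : Fin k → Fin n} (v : Fin k → ℝ) (x : Fin n)
    (hx : Function.extend β v 0 x ≠ 0) : x ∈ Finset.univ.image β := by
  by_contra hcon
  rw [Function.extend_apply' _ _ _ (by simpa using hcon)] at hx
  exact hx rfl

theorem vari_extend_lt {n k : ℕ} {β : Fin k → Fin n} (hβ : Function.Injective β)
    {v : Fin k → ℝ} (hv : v ≠ 0) : vari (Function.extend β v 0) < k := by
  have h := vari_lt_card_of_support (extend_ne_zero hβ hv) (extend_support v)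
  rwa [Finset.card_image_of_injective _ hβ, Finset.card_univ, Fintype.card_fin] at h

section

variable {n k : ℕ} {M : Matrix ℕ (Fin n) ℝ} {X : (Fin n → ℝ) →ₗ[ℝ] (ℕ → ℝ)}

theorem IsSVB.not_le (hX : IsSVB (k - 1) X) (hk : 1 ≤ k) {u : Fin n → ℝ} (hu : u ≠ 0)
    (hvar : vari u < k) : ¬ (k : ℕ∞) ≤ variz (X u) := by
  intro hle
  have h1 := hX u hu (by omega)
  have h2 := hle.trans h1
  rw [Nat.cast_le] at h2
  omega

theorem IsSVB.det_ne_zero (hX : IsSVB (k - 1) X) (hk : 1 ≤ k) (hM : ∀ u t, X u t = M t ⬝ᵥ u)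
    {α : Fin k → ℕ} (hα : StrictMono α) {β : Fin k → Fin n} (hβ : StrictMono β) :
    (M.submatrix α β).det ≠ 0 := by
  intro hdet
  obtain ⟨v, hv, hMv⟩ := Matrix.exists_mulVec_eq_zero_iff.2 hdet
  refine hX.not_le hk (extend_ne_zero hβ.injective hv) (vari_extend_lt hβ.injective hv)
    (le_variz_of_zeros hα fun i => ?_)
  rw [hM, dotProduct_extend hβ.injective]
  exact congrFun hMv i

/-- The alternating relation among `k + 1` rows, applied to a vector. -/
theorem sum_alternating_minor_mul_mulVec (V : Matrix (Fin (k + 1)) (Fin k) ℝ) (v : Fin k → ℝ) :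
    ∑ j : Fin (k + 1), (-1) ^ (j : ℕ) * (V.submatrix j.succAbove id).det * (V *ᵥ v) j = 0 := by
  simp only [Matrix.mulVec, dotProduct, Finset.mul_sum]
  rw [Finset.sum_comm]
  refine Finset.sum_eq_zero fun l _ => ?_
  have h := congrArg (· * v l) (sum_alternating_minor_mul V l)
  simp only [Finset.sum_mul, zero_mul] at h
  rw [← h]
  exact Finset.sum_congr rfl fun j _ => by ring

/-- The image of a `(k+1) × k` matrix with nonzero last minor is the hyperplane given by the
alternating relation. -/
theorem exists_mulVec_eq {V : Matrix (Fin (k + 1)) (Fin k) ℝ}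
    (hV : (V.submatrix (Fin.last k).succAbove id).det ≠ 0) {y : Fin (k + 1) → ℝ}
    (hy : ∑ j : Fin (k + 1), (-1) ^ (j : ℕ) * (V.submatrix j.succAbove id).det * y j = 0) :
    ∃ v, V *ᵥ v = y := by
  set V₀ := V.submatrix (Fin.last k).succAbove id with hV₀
  set v := V₀⁻¹ *ᵥ (y ∘ (Fin.last k).succAbove) with hv
  have h0 : ∀ j : Fin k, (V *ᵥ v) j.castSucc = y j.castSucc := by
    intro j
    have h1 : V₀ *ᵥ v = y ∘ (Fin.last k).succAbove := by
      rw [hv, Matrix.mulVec_mulVec, Matrix.mul_nonsing_inv _ (isUnit_iff_ne_zero.2 hV),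
        Matrix.one_mulVec]
    have h2 := congrFun h1 j
    simp only [Function.comp, Fin.succAbove_last] at h2
    rw [← h2]
    simp [hV₀, Matrix.mulVec, dotProduct]
  refine ⟨v, funext fun j => ?_⟩
  induction j using Fin.lastCases with
  | cast j => exact h0 j
  | last =>
    have h1 := sum_alternating_minor_mul_mulVec V v
    rw [Fin.sum_univ_castSucc] at h1 hy
    simp only [h0] at h1
    have h2 : (-1 : ℝ) ^ ((Fin.last k : Fin (k + 1)) : ℕ) *
        (V.submatrix (Fin.last k).succAbove id).det * ((V *ᵥ v) (Fin.last k) - y (Fin.last k))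
        = 0 := by
      rw [mul_sub]
      linarith
    rcases mul_eq_zero.1 h2 with h3 | h3
    · exact absurd h3 (mul_ne_zero (pow_ne_zero _ (by norm_num)) hV)
    · linarith

/-- Reals of mixed sign admit a vanishing combination with positive weights. -/
theorem exists_pos_weights {ι : Type*} [Fintype ι] {m : ι → ℝ} {a b : ι} (h : m a * m b < 0) :
    ∃ w : ι → ℝ, (∀ j, 0 < w j) ∧ ∑ j, w j * m j = 0 := by
  classical
  obtain ⟨c, hc0, hc⟩ : ∃ c, m c ≠ 0 ∧ (∑ j, m j) / m c ≤ 0 := by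
    by_cases ha : (∑ j, m j) / m a ≤ 0
    · exact ⟨a, left_ne_zero_of_mul h.ne, ha⟩
    · refine ⟨b, right_ne_zero_of_mul h.ne, ?_⟩
      have h1 : (∑ j, m j) / m b = ((∑ j, m j) / m a) * ((m a * m b) / (m b * m b)) := by
        have := left_ne_zero_of_mul h.ne
        have := right_ne_zero_of_mul h.ne
        field_simp
      rw [h1]
      exact mul_nonpos_of_nonneg_of_nonpos (not_le.1 ha).le
        (div_nonpos_of_nonpos_of_nonneg h.le (mul_self_nonneg _))
  refine ⟨fun j => 1 + if j = c then -((∑ j, m j) / m c) else 0, fun j => ?_, ?_⟩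
  · by_cases hj : j = c
    · simp only [hj, if_true]
      linarith
    · simp [hj]
  · simp only [add_mul, one_mul, Finset.sum_add_distrib, ite_mul, zero_mul,
      Finset.sum_ite_eq', Finset.mem_univ, if_true]
    field_simp
    ring

theorem IsSVB.row_exchange (hX : IsSVB (k - 1) X) (hk : 1 ≤ k) (hM : ∀ u t, X u t = M t ⬝ᵥ u)
    {g : Fin (k + 1) → ℕ} (hg : StrictMono g) {β : Fin k → Fin n} (hβ : StrictMono β)
    (a b : Fin (k + 1)) :
    0 < (M.submatrix (g ∘ a.succAbove) β).det * (M.submatrix (g ∘ b.succAbove) β).det := by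
  have hne : ∀ j : Fin (k + 1), (M.submatrix (g ∘ j.succAbove) β).det ≠ 0 := fun j =>
    hX.det_ne_zero hk hM (hg.comp (Fin.strictMono_succAbove j)) hβ
  by_contra hcon
  have hneg := lt_of_le_of_ne (not_lt.1 hcon) (mul_ne_zero (hne a) (hne b))
  obtain ⟨w, hw, hsum⟩ := exists_pos_weights
    (m := fun j : Fin (k + 1) => (M.submatrix (g ∘ j.succAbove) β).det) hneg
  have hsq : ∀ j : ℕ, ((-1 : ℝ) ^ j) * (-1) ^ j = 1 := fun j => by rw [← mul_pow]; simp
  -- an alternating vector in the image of the columns `β`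
  obtain ⟨v, hv⟩ := exists_mulVec_eq (V := M.submatrix g β) (hne (Fin.last k))
    (y := fun j => (-1) ^ (j : ℕ) * w j) (by
      rw [← hsum]
      refine Finset.sum_congr rfl fun j _ => ?_
      change (-1) ^ (j : ℕ) * (M.submatrix (g ∘ j.succAbove) β).det * ((-1) ^ (j : ℕ) * w j) = _
      linear_combination (M.submatrix (g ∘ j.succAbove) β).det * w j * hsq j)
  have hv0 : v ≠ 0 := by
    rintro rfl
    have := congrFun hv 0
    simp at this
    exact (hw 0).ne this
  refine hX.not_le hk (extend_ne_zero hβ.injective hv0) (vari_extend_lt hβ.injective hv0)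
    (le_variz hg one_ne_zero fun j => ?_)
  rw [hM, dotProduct_extend hβ.injective]
  have h1 : (M (g j) ∘ β) ⬝ᵥ v = (-1) ^ (j : ℕ) * w j := congrFun hv j
  rw [h1, one_mul, ← mul_assoc, hsq, one_mul]
  exact (hw j).le

theorem IsSVB.col_exchange (hX : IsSVB (k - 1) X) (hk : 1 ≤ k) (hM : ∀ u t, X u t = M t ⬝ᵥ u)
    {α : Fin k → ℕ} (hα : StrictMono α) {g : Fin (k + 1) → Fin n} (hg : StrictMono g)
    (a b : Fin (k + 1)) :
    0 < (M.submatrix α (g ∘ a.succAbove)).det * (M.submatrix α (g ∘ b.succAbove)).det := by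
  have hne : ∀ j : Fin (k + 1), (M.submatrix α (g ∘ j.succAbove)).det ≠ 0 := fun j =>
    hX.det_ne_zero hk hM hα (hg.comp (Fin.strictMono_succAbove j))
  refine mul_pos_of_adjacent (m := fun j => (M.submatrix α (g ∘ j.succAbove)).det) hne
    (fun j => ?_) a b
  by_contra hcon
  have hneg := lt_of_le_of_ne (not_lt.1 hcon) (mul_ne_zero (hne _) (hne _))
  -- the kernel vector of the columns `g` has two adjacent entries of equal sign
  set w : Fin (k + 1) → ℝ := fun j => (-1) ^ (j : ℕ) * (M.submatrix α (g ∘ j.succAbove)).det with hw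
  have hpos : 0 < w j.castSucc * w j.succ := by
    have hsq : ((-1 : ℝ) ^ (j : ℕ)) * (-1) ^ (j : ℕ) = 1 := by rw [← mul_pow]; simp
    simp only [hw, Fin.val_castSucc, Fin.val_succ, pow_succ]
    linear_combination hneg +
      (M.submatrix α (g ∘ j.castSucc.succAbove)).det *
        (M.submatrix α (g ∘ j.succ.succAbove)).det * hsq
  have hw0 : w ≠ 0 := fun h => by simp [h] at hpos
  have hval : ∀ j, Function.extend g w 0 (g j) = w j := hg.injective.extend_apply w 0
  have hvar := vari_add_one_lt_card_of_support (u := Function.extend g w 0) (extend_support w)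
    (hg (Fin.castSucc_lt_succ (i := j))) (fun l h1 h2 => by
      refine Function.extend_apply' _ _ _ ?_
      rintro ⟨i, rfl⟩
      have h3 := hg.lt_iff_lt.1 h1
      have h4 := hg.lt_iff_lt.1 h2
      simp only [Fin.lt_def, Fin.val_castSucc, Fin.val_succ] at h3 h4
      omega) (by rw [hval, hval]; exact hpos)
  rw [Finset.card_image_of_injective _ hg.injective, Finset.card_univ, Fintype.card_fin] at hvar
  refine hX.not_le hk (extend_ne_zero hg.injective hw0) (by push_cast at hvar; linarith)
    (le_variz_of_zeros hα fun i => ?_)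
  rw [hM, dotProduct_extend hg.injective]
  have h1 := sum_alternating_minor_mul (M.submatrix α g)ᵀ i
  rw [← h1, dotProduct]
  refine Finset.sum_congr rfl fun j _ => ?_
  have h2 : ((M.submatrix α g)ᵀ.submatrix j.succAbove id).det
      = (M.submatrix α (g ∘ j.succAbove)).det := by
    rw [← Matrix.det_transpose]
    rfl
  rw [h2]
  simp only [hw, Function.comp, Matrix.transpose_apply, Matrix.submatrix_apply]
  ring

/-! ### The variation bounding property from strict sign consistency -/

/-- If all maximal minors of `P` have the strict sign of `σ`, so does the determinant of the matrix
obtained by adding up the columns of `P` over consecutive blocks with nonnegative weights, not all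
zero on any block. -/
theorem det_mul_block_pos {σ : ℝ} {P : Matrix (Fin k) (Fin n) ℝ}
    (hP : ∀ β : Fin k → Fin n, StrictMono β → 0 < σ * (P.submatrix id β).det)
    {b : Fin n → Fin k} (hb : Monotone b) {w : Fin n → ℝ} (hw : ∀ j, 0 ≤ w j)
    (hwpos : ∀ c, ∃ j, b j = c ∧ 0 < w j) :
    0 < σ * (P * Matrix.of fun j c => if b j = c then w j else 0).det := by
  set W : Matrix (Fin n) (Fin k) ℝ := Matrix.of fun j c => if b j = c then w j else 0 with hW
  have hWdiag : ∀ J : Fin k → Fin n, (∀ c, b (J c) = c) →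
      (W.submatrix J id).det = ∏ c, w (J c) := by
    intro J hJ
    have : W.submatrix J id = Matrix.diagonal fun c => w (J c) := by
      ext c d
      simp [hW, hJ, Matrix.diagonal_apply]
    rw [this, Matrix.det_diagonal]
  have hWnonneg : ∀ J : IncTuple n k, 0 ≤ (W.submatrix J.idx id).det := by
    intro J
    by_cases hinj : Function.Injective (b ∘ J.idx)
    · have hmono : StrictMono (b ∘ J.idx) :=
        (hb.comp J.strictMono.monotone).strictMono_of_injective hinj
      have hid : b ∘ J.idx = id := (hmono.range_inj strictMono_id).1 (by
        rw [Set.range_id, (Finite.injective_iff_surjective.1 hinj).range_eq])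
      rw [hWdiag J.idx (congrFun hid)]
      exact Finset.prod_nonneg fun c _ => hw _
    · have hsurj : ¬ Function.Surjective (b ∘ J.idx) := fun h =>
        hinj (Finite.injective_iff_surjective.2 h)
      obtain ⟨c, hc⟩ := not_forall.1 hsurj
      refine (Matrix.det_eq_zero_of_column_eq_zero c fun i => ?_).ge
      have : b (J.idx i) ≠ c := fun h => hc ⟨i, h⟩
      simp [hW, this]
  choose j hj1 hj2 using hwpos
  have hjmono : StrictMono j := by
    intro c d hcd
    by_contra hle
    have := hb (not_lt.1 hle)
    rw [hj1, hj1] at this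
    exact absurd hcd (not_lt.2 this)
  rw [det_mul_eq_sum_incTuple, Finset.mul_sum]
  refine Finset.sum_pos' (fun J _ => ?_) ⟨IncTuple.ofStrictMono j hjmono, Finset.mem_univ _, ?_⟩
  · rw [← mul_assoc]
    exact mul_nonneg (hP _ J.strictMono).le (hWnonneg J)
  · rw [← mul_assoc]
    refine mul_pos (hP _ hjmono) ?_
    rw [IncTuple.idx_ofStrictMono, hWdiag j hj1]
    exact Finset.prod_pos fun c _ => hj2 c

theorem isSVB_of_sign_consistent (hk : 1 ≤ k) (hkn : k ≤ n) (hM : ∀ u t, X u t = M t ⬝ᵥ u) {σ : ℝ}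
    (hσ : ∀ α : Fin k → ℕ, StrictMono α → ∀ β : Fin k → Fin n, StrictMono β →
      0 < σ * (M.submatrix α β).det) : IsSVB (k - 1) X := by
  classical
  obtain ⟨m, rfl⟩ : ∃ m, k = m + 1 := ⟨k - 1, by omega⟩
  intro u hu hvar
  rw [Nat.add_sub_cancel] at hvar ⊢
  by_contra hcon
  obtain ⟨i, hi, τ, hτ, halt⟩ := exists_of_not_variz_le hcon
  obtain ⟨b, hb, hbsurj, hsign⟩ := exists_monotone_block hkn hu hvar
  -- a representative of each block, at which `u` does not vanish if possible
  have hrep : ∀ c, ∃ j, b j = c ∧ (u j = 0 → ∀ l, b l = c → u l = 0) := by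
    intro c
    by_cases h : ∃ j, b j = c ∧ u j ≠ 0
    · obtain ⟨j, h1, h2⟩ := h
      exact ⟨j, h1, fun h => absurd h h2⟩
    · push Not at h
      obtain ⟨j, hj⟩ := hbsurj c
      exact ⟨j, hj, fun _ => h⟩
  choose j₀ hj₀ hj₀' using hrep
  set w : Fin n → ℝ := fun j => if u (j₀ (b j)) = 0 then 1 else u j * u (j₀ (b j)) with hw
  set v : Fin (m + 1) → ℝ := fun c => (u (j₀ c))⁻¹ with hv
  set W : Matrix (Fin n) (Fin (m + 1)) ℝ := Matrix.of fun j c => if b j = c then w j else 0 with hW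
  have hWv : W *ᵥ v = u := by
    funext j
    simp only [hW, Matrix.mulVec, dotProduct, Matrix.of_apply, ite_mul, zero_mul,
      Finset.sum_ite_eq, Finset.mem_univ, if_true, hw, hv]
    by_cases h : u (j₀ (b j)) = 0
    · simp [h, hj₀' _ h j rfl]
    · rw [if_neg h, mul_assoc, mul_inv_cancel₀ h, mul_one]
  have hpos : ∀ α : Fin (m + 1) → ℕ, StrictMono α → 0 < σ * (M.submatrix α id * W).det := by
    intro α hα
    refine det_mul_block_pos (fun β hβ => hσ α hα β hβ) hb (fun j => ?_) (fun c => ?_)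
    · simp only [hw]
      split_ifs
      · exact zero_le_one
      · exact hsign _ _ (hj₀ _).symm
    · refine ⟨j₀ c, hj₀ c, ?_⟩
      simp only [hw, hj₀]
      split_ifs with h
      · exact zero_lt_one
      · exact mul_self_pos.2 h
  have hXu : ∀ t, X u t = ((M * W) *ᵥ v) t := fun t => by
    rw [hM, ← Matrix.mulVec_mulVec, hWv]
    rfl
  have hsub : ∀ j : Fin (m + 2), ((M.submatrix i id * W).submatrix j.succAbove id)
      = M.submatrix (i ∘ j.succAbove) id * W := fun j => rfl
  have hrel := sum_alternating_minor_mul_mulVec (M.submatrix i id * W) v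
  have hterm : ∀ j : Fin (m + 2), 0 < σ * (M.submatrix (i ∘ j.succAbove) id * W).det := fun j =>
    hpos _ (hi.comp (Fin.strictMono_succAbove j))
  have hmv : ∀ j, ((M.submatrix i id * W) *ᵥ v) j = X u (i j) := fun j => by
    rw [hXu]
    rfl
  simp only [hsub, hmv] at hrel
  have hsum : ∑ j : Fin (m + 2), (σ * (M.submatrix (i ∘ j.succAbove) id * W).det) *
      (τ * (-1) ^ (j : ℕ) * X u (i j)) = 0 := by
    have := congrArg (σ * τ * ·) hrel
    simp only [Finset.mul_sum, mul_zero] at this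
    rw [← this]
    exact Finset.sum_congr rfl fun j _ => by ring
  have hzero := (Finset.sum_eq_zero_iff_of_nonneg
    (fun j _ => mul_nonneg (hterm j).le (halt j))).1 hsum
  have hXzero : ∀ j, X u (i j) = 0 := by
    intro j
    rcases mul_eq_zero.1 (hzero j (Finset.mem_univ j)) with h | h
    · exact absurd h (hterm j).ne'
    · exact (mul_eq_zero.1 h).resolve_left (mul_ne_zero hτ (pow_ne_zero _ (by norm_num)))
  have hv0 : v = 0 := Matrix.eq_zero_of_mulVec_eq_zero
    (M := M.submatrix (i ∘ (0 : Fin (m + 2)).succAbove) id * W)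
    (right_ne_zero_of_mul (hterm 0).ne') (funext fun l => (hmv _).trans (hXzero _))
  exact hu (by rw [← hWv, hv0, Matrix.mulVec_zero])

/-- An operator is strictly `k - 1`-variation bounding if and only if all minors of order `k` of its
matrix have the same strict sign. -/
theorem isSVB_iff_sign_consistent (hk : 1 ≤ k) (hkn : k ≤ n) (hM : ∀ u t, X u t = M t ⬝ᵥ u) :
    IsSVB (k - 1) X ↔ ∃ σ : ℝ, ∀ α : Fin k → ℕ, StrictMono α → ∀ β : Fin k → Fin n, StrictMono β →
      0 < σ * (M.submatrix α β).det := by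
  refine ⟨fun hX => ⟨(M.submatrix (fun i : Fin k => (i : ℕ)) (Fin.castLE hkn)).det,
    fun α hα β hβ => ?_⟩, fun ⟨σ, hσ⟩ => isSVB_of_sign_consistent hk hkn hM hσ⟩
  have hα₀ : StrictMono (fun i : Fin k => (i : ℕ)) := fun _ _ h => h
  have hβ₀ : StrictMono (Fin.castLE hkn) := Fin.strictMono_castLE hkn
  have h1 := mul_pos_of_exchange (F := fun α : Fin k → ℕ => (M.submatrix α (Fin.castLE hkn)).det)
    (fun f hf => hX.det_ne_zero hk hM hf hβ₀)
    (fun g hg a b => hX.row_exchange hk hM hg hβ₀ a b) hα₀ hα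
  have h2 := mul_pos_of_exchange (F := fun β : Fin k → Fin n => (M.submatrix α β).det)
    (fun f hf => hX.det_ne_zero hk hM hα hf)
    (fun g hg a b => hX.col_exchange hk hM hα hg a b) hβ₀ hβ
  have h3 := mul_pos h1 h2
  have h4 : ∀ x y z : ℝ, x * y * (y * z) = x * z * (y * y) := fun x y z => by ring
  rw [h4] at h3
  exact (pos_iff_pos_of_mul_pos h3).2 (mul_self_pos.2 (hX.det_ne_zero hk hM hα hβ₀))

end

/-! ### The test minors -/

/-- The infinite observability matrix with rows `c Aᵗ`, `t ≥ 0`. -/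
def obsRows {n : ℕ} (A : Matrix (Fin n) (Fin n) ℝ) (c : Fin n → ℝ) : Matrix ℕ (Fin n) ℝ :=
  Matrix.of fun t => c ᵥ* (A ^ t)

theorem obsOp_apply {n : ℕ} (A : Matrix (Fin n) (Fin n) ℝ) (c : Fin n → ℝ) (u : Fin n → ℝ)
    (t : ℕ) : obsOp A c u t = obsRows A c t ⬝ᵥ u :=
  Matrix.dotProduct_mulVec c (A ^ t) u

/-- The minors of `𝒪` with row set `(1:k-r) ∪ (s+1:s+r)` are impulse responses. -/
theorem det_obsRows_eq_impulseResponse {n k : ℕ} {A : Matrix (Fin n) (Fin n) ℝ} {c : Fin n → ℝ}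
    (hobs : IsObservable A c) (hkn : k ≤ n) {r s : ℕ} (hrk : r ≤ k)
    (hs : k - r ≤ s) {f : Fin k → ℕ} (hf : StrictMono f)
    (hrange : Set.range f = ((Finset.range (k - r) ∪ Finset.Ico s (s + r) : Finset ℕ) : Set ℕ))
    (β : IncTuple n k) :
    ((obsRows A c).submatrix f β.idx).det =
      impulseResponse (compA A r) (compB A c r β) (compC A c r) (s - (k - r) + 1) := by
  obtain ⟨m, rfl⟩ : ∃ m, k = m + r := ⟨k - r, by omega⟩
  rw [Nat.add_sub_cancel] at hs hrange ⊢
  have hN : (s - m) + (m + r) ≤ s + r := by omega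
  rw [← det_obsMat_submatrix_initBlockTuple A c hobs hkn β hN]
  have hmono : StrictMono fun i => ((initBlockTuple (m := m) (r := r) (s - m) hN).idx i : ℕ) :=
    (initBlockTuple (m := m) (r := r) (s - m) hN).strictMono
  have hfeq : f = fun i => ((initBlockTuple (m := m) (r := r) (s - m) hN).idx i : ℕ) := by
    refine (hf.range_inj hmono).1 ?_
    rw [hrange]
    ext x
    simp only [initBlockTuple_idx_val, Finset.coe_union, Finset.coe_range, Finset.coe_Ico,
      Set.mem_union, Set.mem_Iio, Set.mem_Ico, Set.mem_range]
    constructor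
    · rintro (h | ⟨h1, h2⟩)
      · exact ⟨⟨x, by omega⟩, if_pos h⟩
      · exact ⟨⟨x - (s - m), by omega⟩, by simp only; split_ifs <;> omega⟩
    · rintro ⟨i, rfl⟩
      have := i.2
      split_ifs <;> omega
  rw [hfeq]
  rfl

/-- A tuple with values in `(1:n)` and range `(1:k-r) ∪ (s+1:s+r)` is one of the test tuples. -/
theorem isTestTuple_of_range {n k : ℕ} (β : IncTuple n k) {r s : ℕ} (hr : 1 ≤ r) (hrk : r ≤ k)
    (hs : k - r ≤ s) (hsn : s + r ≤ n)
    (hrange : Set.range (fun i => (β.idx i : ℕ)) =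
      ((Finset.range (k - r) ∪ Finset.Ico s (s + r) : Finset ℕ) : Set ℕ)) : IsTestTuple β := by
  refine ⟨r, s + 1, hr, hrk, by omega, by omega, ?_⟩
  have h : Set.range (fun i : Fin k => (β.idx i : ℕ) + 1)
      = (· + 1) '' Set.range (fun i => (β.idx i : ℕ)) := (Set.range_comp _ _)
  rw [IsInitBlock, h, hrange]
  ext x
  simp only [Finset.coe_union, Finset.coe_range, Finset.coe_Ico, Set.mem_image, Set.mem_union,
    Set.mem_Iio, Set.mem_Ico, Set.mem_Icc]
  constructor
  · rintro ⟨y, hy, rfl⟩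
    omega
  · intro hx
    exact ⟨x - 1, by omega, by omega⟩

/-- If the impulse responses of all tested compound systems have the strict sign of `σ`, then so
have all minors of order `k` of `𝒪`: the criterion `minorPos_of_initBlock` is applied to the rows,
for each test tuple of columns, and then to the columns. -/
theorem obsRows_sign_consistent {n k : ℕ} {A : Matrix (Fin n) (Fin n) ℝ} {c : Fin n → ℝ}
    (hobs : IsObservable A c) (hk : 1 ≤ k) (hkn : k ≤ n) {σ : ℝ}
    (h : ∀ r : ℕ, 1 ≤ r → r ≤ k → ∀ β : IncTuple n k, IsTestTuple β → ∀ t : ℕ, 1 ≤ t →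
      0 < σ * impulseResponse (compA A r) (compB A c r β) (compC A c r) t)
    {α : Fin k → ℕ} (hα : StrictMono α) {β : Fin k → Fin n} (hβ : StrictMono β) :
    0 < σ * ((obsRows A c).submatrix α β).det := by
  have hbound : ∀ f : Fin k → ℕ, ∃ N, ∀ i, f i < N := fun f =>
    ⟨Finset.univ.sup f + 1, fun i => Nat.lt_succ_of_le (Finset.le_sup (Finset.mem_univ i))⟩
  have himage : ∀ {f : Fin k → ℕ}, StrictMono f → (Finset.univ.image f).card = k := fun hf => by
    rw [Finset.card_image_of_injective _ hf.injective, Finset.card_univ, Fintype.card_fin]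
  have hrow : ∀ β : IncTuple n k, IsTestTuple β →
      0 < σ * ((obsRows A c).submatrix α β.idx).det := by
    intro β hβ
    obtain ⟨N, hN⟩ := hbound α
    refine minorPos_of_initBlock (N := N) hk (V := (obsRows A c).submatrix id β.idx)
      (S := Finset.univ.image α) ?_ ?_ (himage hα) α hα (by simp)
    · intro r s hr hrk hs _ f hf hrange
      have := h r hr hrk β hβ (s - (k - r) + 1) (Nat.le_add_left _ _)
      rwa [← det_obsRows_eq_impulseResponse hobs hkn hrk hs hf hrange β] at this
    · intro x hx
      obtain ⟨i, -, rfl⟩ := Finset.mem_image.1 hx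
      exact Finset.mem_range.2 (hN i)
  -- the transposed rows `α`, continued by zero to row indices `≥ n`
  set V : Matrix ℕ (Fin k) ℝ := Matrix.of fun j i =>
    if hj : j < n then obsRows A c (α i) ⟨j, hj⟩ else 0 with hV
  have hVdet : ∀ β : Fin k → Fin n, (V.submatrix (fun i => (β i : ℕ)) id).det
      = ((obsRows A c).submatrix α β).det := by
    intro β
    rw [← Matrix.det_transpose]
    congr 1
    ext i j
    simp [hV]
  have hβ' : StrictMono fun i => (β i : ℕ) := hβ
  rw [← hVdet]
  refine minorPos_of_initBlock (N := n) hk (V := V) (S := Finset.univ.image fun i => (β i : ℕ))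
    ?_ ?_ (himage hβ') _ hβ' (by simp)
  · intro r s hr hrk hs hsn f hf hrange
    have hfn : ∀ i, f i < n := by
      intro i
      have hi : f i ∈ Set.range f := ⟨i, rfl⟩
      rw [hrange, Finset.mem_coe, Finset.mem_union, Finset.mem_range, Finset.mem_Ico] at hi
      omega
    have := hrow (IncTuple.ofStrictMono (fun i => ⟨f i, hfn i⟩) hf)
      (isTestTuple_of_range _ hr hrk hs hsn hrange)
    rw [← hVdet] at this
    exact this
  · intro x hx
    obtain ⟨i, -, rfl⟩ := Finset.mem_image.1 hx
    exact Finset.mem_range.2 (β i).2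

end

theorem theorem2 {n : ℕ} (A : Matrix (Fin n) (Fin n) ℝ) (c : Fin n → ℝ)
    (hobs : IsObservable A c) (k : ℕ) (hk1 : 1 ≤ k) (hkn : k ≤ n) :
    (∀ r : ℕ, 1 ≤ r → r ≤ k → ∀ β : IncTuple n k, ∀ N : ℕ, 1 ≤ N →
      ∀ t : ℕ, 1 ≤ t → t + k ≤ N + 1 →
      ∃ α : IncTuple N k, IsInitBlock r (k - r + t) α ∧
        ((obsMat A c N).submatrix α.idx β.idx).det =
          impulseResponse (compA A r) (compB A c r β) (compC A c r) t) ∧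
    (IsSVB (k - 1) (obsOp A c) ↔
      ((∀ r : ℕ, 1 ≤ r → r ≤ k → ∀ β : IncTuple n k, IsTestTuple β →
          StrictlyExtPos (compA A r) (compB A c r β) (compC A c r)) ∨
        (∀ r : ℕ, 1 ≤ r → r ≤ k → ∀ β : IncTuple n k, IsTestTuple β →
          StrictlyExtNeg (compA A r) (compB A c r β) (compC A c r)))) := by
  have hmain : ∀ r : ℕ, 1 ≤ r → r ≤ k → ∀ β : IncTuple n k, ∀ N : ℕ,
      ∀ t : ℕ, 1 ≤ t → t + k ≤ N + 1 →
      ∃ α : IncTuple N k, IsInitBlock r (k - r + t) α ∧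
        ((obsMat A c N).submatrix α.idx β.idx).det =
          impulseResponse (compA A r) (compB A c r β) (compC A c r) t := by
    intro r hr hrk β N t ht htN
    obtain ⟨m, rfl⟩ : ∃ m, k = m + r := ⟨k - r, by omega⟩
    obtain ⟨s, rfl⟩ : ∃ s, t = s + 1 := ⟨t - 1, by omega⟩
    have hN : s + (m + r) ≤ N := by omega
    refine ⟨initBlockTuple s hN, ?_, det_obsMat_submatrix_initBlockTuple A c hobs hkn β hN⟩
    rw [Nat.add_sub_cancel]
    exact isInitBlock_initBlockTuple hN hr
  refine ⟨fun r hr hrk β N _ t ht htN => hmain r hr hrk β N t ht htN, ?_⟩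
  rw [isSVB_iff_sign_consistent hk1 hkn (obsOp_apply A c)]
  constructor
  · rintro ⟨σ, hσ⟩
    have himp : ∀ r : ℕ, 1 ≤ r → r ≤ k → ∀ β : IncTuple n k, ∀ t : ℕ, 1 ≤ t →
        0 < σ * impulseResponse (compA A r) (compB A c r β) (compC A c r) t := by
      intro r hr hrk β t ht
      obtain ⟨α, -, hα⟩ := hmain r hr hrk β (t + k) t ht (Nat.le_succ _)
      rw [← hα]
      exact hσ (fun i => (α.idx i : ℕ)) α.strictMono β.idx β.strictMono
    rcases le_or_gt 0 σ with hs | hs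
    · exact Or.inl fun r hr hrk β _ t ht => pos_of_mul_pos_right (himp r hr hrk β t ht) hs
    · exact Or.inr fun r hr hrk β _ t ht => neg_of_mul_pos_right (himp r hr hrk β t ht) hs.le
  · rintro (h | h)
    · refine ⟨1, fun α hα β hβ => obsRows_sign_consistent hobs hk1 hkn ?_ hα hβ⟩
      intro r hr hrk β hβ t ht
      simpa using h r hr hrk β hβ t ht
    · refine ⟨-1, fun α hα β hβ => obsRows_sign_consistent hobs hk1 hkn ?_ hα hβ⟩
      intro r hr hrk β hβ t ht
      simpa using h r hr hrk β hβ t ht
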